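/- **Setting.** Let $\mathbb F$ be a finite field, $N$ the number of clients, $T\ge 0$ an integer with $2T<N$, $K=\lfloor (N+1)/2\rfloor-T$, and $d\ge 0$ with $K\mid d+1$; put $s=(d+1)/K$ and $\widetilde K=K+2T-1$. Assume that $1,\dots,N$ are invertible in $\mathbb F$, and let $\alpha_1,\dots,\alpha_N,\beta_1,\dots,\beta_{K+T}\in\mathbb F$ be pairwise distinct. Client $n$ holds a subset $\mathcal E_n$ of a finite set of entities and a local embedding $\mathbf h_{n,e}\in\mathbb F^d$ for each $e\in\mathcal E_n$. Let $\mathcal E=\bigcup_n\mathcal E_n=\{e_1,\dots,e_M\}$, and for $e\in\mathcal E$ let $\bar{\mathbf h}_e=\frac{1}{|\{v:\,e\in\mathcal E_v\}|}\sum_{v:\,e\in\mathcal E_v}\mathbf h_{v,e}$. **Primitives** (with a security parameter $\lambda$): a private set union (PSU) protocol by which the clients always obtain $\mathcal E$, whose messages are vectors over $\mathbb F$ of polynomial total length; a Diffie–Hellman type key exchange; a pseudorandom generator with outputs over $\mathbb F$; an additively homomorphic public-key encryption scheme $\mathrm{PHE}$ with plaintexts in $\mathbb F$ (the product of a ciphertext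 of $m_1$ with a fresh encryption of $m_2$ is distributed as a fresh encryption of $m_1+m_2$, and the $r$-th power of a ciphertext of $m$ is a ciphertext of $rm$). All messages between clients pass through the server and are masked by one-time pads generated from seeds that are agreed on separately for each ordered pair of clients and each of the three purposes: union, sharing, queries. **Protocol (SecEA), one aggregation round.** 1. The clients run the PSU protocol, after which all clients and the server know $\mathcal E$. 2. *Sharing.* Put $\tilde{\mathbf h}_{n,e}=(\mathbf h_{n,e},1)\in\mathbb F^{d+1}$ if $e\in\mathcal E_n$ and $\tilde{\mathbf h}_{n,e}=\mathbf 0$ otherwise, and split it into $K$ sub-vectors $\tilde{\mathbf h}^k_{n,e}\in\mathbb F^s$. For each $e\in\mathcal E$, client $n$ forms the polynomial $\varphi_{n,e}$ of degree $<K+T$ with $\varphi_{n,e}(\beta_k)=\tilde{\mathbf h}^k_{n,e}$ for $k\le K$ and uniform random values at $\beta_{K+1},\dots,\beta_{K+T}$, and sends $\varphi_{n,e}(\alpha_v)$ to each client $v$. Client $v$ adds up the shares that it receives. 3. *Retrieval.* For each $e\in\mathcal E_n$, client $n$ forms polynomials $\rho^m_{n,e}$ ($m\le M$) of degree $<K+T$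 with value $\mathbf 1(e_m=e)$ at $\beta_1,\dots,\beta_K$ and uniform random values at $\beta_{K+1},\dots,\beta_{K+T}$, and sends $(\rho^m_{n,e}(\alpha_v))_m$ to each client $v$. Client $v$ encrypts $A_{v,n,e}=\sum_m\rho^m_{n,e}(\alpha_v)\sum_{v'}\varphi_{v',e_m}(\alpha_v)$ with the $\mathrm{PHE}$ key of client $n$ and sends the ciphertext to the server. The server homomorphically turns it into a ciphertext of $r_{n,e}A_{v,n,e}+\psi_{n,e}(\alpha_v)$ and sends this to client $n$, where $r_{n,e}\in\mathbb F\setminus\{0\}$ is uniform and $\psi_{n,e}$ is the polynomial of degree $\le 2(K+T-1)$ that vanishes at $\beta_1,\dots,\beta_K$ and has uniform random values at $\alpha_1,\dots,\alpha_{\widetilde K}$. Client $n$ decrypts, interpolates through the $N$ values, evaluates at $\beta_1,\dots,\beta_K$ to get a vector in $\mathbb F^{d+1}$, and divides its first $d$ coordinates by the last one. All parties follow the protocol. The view of a party consists of its input, its coins and all messages it receives. **Theorem.** (i) *Correctness.* In every execution, each client $n$ obtains $\bar{\mathbf h}_e$ for every $e\in\mathcal E_n$, that is, the average over exactly the clients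 that hold $e$. So all aggregation opportunities are used. (ii) *Privacy against colluding clients.* Let $\mathcal T$ be a set of at most $T$ clients, and consider two inputs $(\mathcal E_n,\mathbf h_{n,e})$ and $(\mathcal E'_n,\mathbf h'_{n,e})$ that have the same union of entity sets, the same cardinalities $|\mathcal E_n|=|\mathcal E_n'|$ for all $n$, the same entity sets and local embeddings at the clients in $\mathcal T$, and the same averages $\bar{\mathbf h}_e=\bar{\mathbf h}'_e$ for every $e\in\bigcup_{n\in\mathcal T}\mathcal E_n$. Then the joint views of $\mathcal T$ without the messages of the PSU protocol have the same distribution for the two inputs. If moreover the PSU protocol is statistically private against coalitions of up to $T$ clients (the views of a coalition for any two families of sets with the same union and the same sets at the coalition are statistically indistinguishable), then the joint views of $\mathcal T$ in the whole protocol are statistically indistinguishable. (iii) *Privacy against the server.* Suppose that the agreed key of the key exchange is indistinguishable from a random key for an eavesdropper, the generator is pseudorandom, and $\mathrm{PHE}$ is semantically secure, all against families of Boolean circuits of polynomial size. Then for any two inputs with the same union of entity sets and the same cardinalities $|\mathcal E_n|$, the views of the server are computationally indistinguishable, against families of Boolean circuits of polynomial size. Hence SecEA is $T$-private for every $T<N/2$: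 entity privacy and embedding privacy hold simultaneously, apart from the union of all entity sets and their cardinalities, against the server in a computational sense and against any coalition of up to $T$ clients in a statistical sense. -/

import Mathlib

namespace SecEA

/-! ### Negligible functions, statistical and computational indistinguishability -/

/-- A quantity that grows at most polynomially in the security parameter. -/
def PolyBounded (f : ℕ → ℕ) : Prop := ∃ k : ℕ, ∀ l, f l ≤ l ^ k + k

/-- A quantity that vanishes faster than every inverse polynomial in the security parameter. -/
def Negligible (f : ℕ → ℝ) : Prop :=
  Asymptotics.SuperpolynomialDecay Filter.atTop (fun l : ℕ => (l : ℝ)) f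

/-- Statistical distance (largest difference of the probabilities of an event) at most `ε`. -/
def StatClose {X : Type} (P Q : PMF X) (ε : ℝ) : Prop :=
  ∀ A : Set X, |(P.toOuterMeasure A).toReal - (Q.toOuterMeasure A).toReal| ≤ ε

/-- Statistical indistinguishability of two families of distributions. -/
def StatIndist {X : ℕ → Type} (P Q : ∀ l, PMF (X l)) : Prop :=
  ∃ ε : ℕ → ℝ, Negligible ε ∧ ∀ l, StatClose (P l) (Q l) (ε l)

/-- A wire of a Boolean circuit: a constant, an input bit, or the output of an earlier gate. -/
inductive Wire where
  | const (b : Bool)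
  | input (i : ℕ)
  | gate (j : ℕ)

/-- The value carried by a wire, for the input `x` and the values `g` of the earlier gates. -/
def Wire.value (x g : List Bool) : Wire → Bool
  | .const b => b
  | .input i => x.getD i false
  | .gate j => g.getD j false

/-- A Boolean circuit: a sequence of NAND gates, each fed by two wires, and an output wire. -/
structure Circuit where
  gates : List (Wire × Wire)
  out : Wire

/-- The number of gates. -/
def Circuit.size (C : Circuit) : ℕ := C.gates.length

/-- The values of all gates, computed in order. -/
def Circuit.gateValues (C : Circuit) (x : List Bool) : List Bool :=
  C.gates.foldl (fun g w => g ++ [!(w.1.value x g && w.2.value x g)]) []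

/-- The output bit on input `x`. -/
def Circuit.eval (C : Circuit) (x : List Bool) : Bool := C.out.value x (C.gateValues x)

/-- Computational indistinguishability: every family of polynomial-size circuits has negligible
advantage in telling the two families of distributions of bit strings apart. -/
def CompIndist (P Q : ℕ → PMF (List Bool)) : Prop :=
  ∀ C : ℕ → Circuit, PolyBounded (fun l => (C l).size) →
    Negligible fun l =>
      |((P l).map (C l).eval true).toReal - ((Q l).map (C l).eval true).toReal|

/-- A fixed-length binary encoding of a type. -/
structure BitCode (X : Type) where
  len : ℕ
  code : X → List Bool
  length_code : ∀ x, (code x).length = len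
  code_injective : Function.Injective code

/-- Concatenation of `n` bit strings. -/
def concat {n : ℕ} (f : Fin n → List Bool) : List Bool := (List.ofFn f).flatten

/-! ### Cryptographic primitives -/

/-- A generator that expands a seed to a sequence over `F` (of any desired length). -/
structure PRG (F : Type) where
  Seed : ℕ → Type
  [seedFintype : ∀ l, Fintype (Seed l)]
  [seedNonempty : ∀ l, Nonempty (Seed l)]
  seedCode : ∀ l, BitCode (Seed l)
  gen : ∀ l, Seed l → ℕ → F

attribute [instance] PRG.seedFintype PRG.seedNonempty

/-- The generator is pseudorandom: its outputs of polynomial length are computable by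
polynomial-size circuits, and computationally indistinguishable from uniform. -/
def PRG.IsSecure {F : Type} [Fintype F] [Nonempty F] (codeF : BitCode F) (G : PRG F) : Prop :=
  ∀ k : ℕ → ℕ, PolyBounded k →
    (∃ q : ℕ → ℕ, PolyBounded q ∧ ∀ l, ∀ i < k l, ∀ b < codeF.len,
      ∃ C : Circuit, C.size ≤ q l ∧ ∀ s : G.Seed l,
        C.eval ((G.seedCode l).code s) = (codeF.code (G.gen l s i)).getD b false) ∧
    CompIndist
      (fun l => (PMF.uniformOfFintype (G.Seed l)).map fun s =>
        concat fun i : Fin (k l) => codeF.code (G.gen l s i))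
      (fun l => (PMF.uniformOfFintype (Fin (k l) → F)).map fun w =>
        concat fun i => codeF.code (w i))

/-- A key exchange of Diffie-Hellman type: each of two parties sends one public message computed
from its secret, and both derive the same key. -/
structure KeyExchange (Key : ℕ → Type) where
  Secret : ℕ → Type
  [secretFintype : ∀ l, Fintype (Secret l)]
  [secretNonempty : ∀ l, Nonempty (Secret l)]
  Pub : ℕ → Type
  pubCode : ∀ l, BitCode (Pub l)
  pub : ∀ l, Secret l → Pub l
  key : ∀ l, Secret l → Pub l → Key l
  key_agree : ∀ l a b, key l a (pub l b) = key l b (pub l a)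

attribute [instance] KeyExchange.secretFintype KeyExchange.secretNonempty

/-- To an eavesdropper, the agreed key looks uniformly random. -/
def KeyExchange.IsSecure {Key : ℕ → Type} [∀ l, Fintype (Key l)] [∀ l, Nonempty (Key l)]
    (keyCode : ∀ l, BitCode (Key l)) (X : KeyExchange Key) : Prop :=
  CompIndist
    (fun l => (PMF.uniformOfFintype (X.Secret l × X.Secret l)).map fun ω =>
      (X.pubCode l).code (X.pub l ω.1) ++ (X.pubCode l).code (X.pub l ω.2) ++
        (keyCode l).code (X.key l ω.1 (X.pub l ω.2)))
    (fun l => (PMF.uniformOfFintype ((X.Secret l × X.Secret l) × Key l)).map fun ω =>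
      (X.pubCode l).code (X.pub l ω.1.1) ++ (X.pubCode l).code (X.pub l ω.1.2) ++
        (keyCode l).code ω.2)

/-- An additively homomorphic public-key encryption scheme with plaintexts in `F`.
`enc_mul` is the law `Enc(m₁) · Enc(m₂) = Enc(m₁ + m₂)` for a randomized scheme: the product of
a ciphertext of `m₁` with a fresh encryption of `m₂` is a fresh encryption of `m₁ + m₂`.
`enc_pow` is the induced law for powers, a power of a ciphertext of `m` with exponent `r` being a
ciphertext of `r * m`. -/
structure PHE (F : Type) [Field F] where
  PK : ℕ → Type
  SK : ℕ → Type
  CT : ℕ → Type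
  KeyCoin : ℕ → Type
  [keyCoinFintype : ∀ l, Fintype (KeyCoin l)]
  [keyCoinNonempty : ∀ l, Nonempty (KeyCoin l)]
  EncCoin : ℕ → Type
  [encCoinFintype : ∀ l, Fintype (EncCoin l)]
  [encCoinNonempty : ∀ l, Nonempty (EncCoin l)]
  pkCode : ∀ l, BitCode (PK l)
  ctCode : ∀ l, BitCode (CT l)
  encCoinCode : ∀ l, BitCode (EncCoin l)
  pk : ∀ l, KeyCoin l → PK l
  sk : ∀ l, KeyCoin l → SK l
  enc : ∀ l, PK l → F → EncCoin l → CT l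
  dec : ∀ l, SK l → CT l → F
  mul : ∀ l, PK l → CT l → CT l → CT l
  pow : ∀ l, PK l → CT l → F → CT l
  dec_enc : ∀ l κ m ρ, dec l (sk l κ) (enc l (pk l κ) m ρ) = m
  enc_mul : ∀ l κ m₁ m₂ ρ₁,
    ((PMF.uniformOfFintype (EncCoin l)).map fun ρ₂ =>
      mul l (pk l κ) (enc l (pk l κ) m₁ ρ₁) (enc l (pk l κ) m₂ ρ₂)) =
    (PMF.uniformOfFintype (EncCoin l)).map fun ρ => enc l (pk l κ) (m₁ + m₂) ρ
  enc_pow : ∀ l κ m ρ r, ∃ ρ',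
    pow l (pk l κ) (enc l (pk l κ) m ρ) r = enc l (pk l κ) (r * m) ρ'

attribute [instance] PHE.keyCoinFintype PHE.keyCoinNonempty PHE.encCoinFintype
  PHE.encCoinNonempty

/-- The public key together with encryptions of the messages `m`. -/
noncomputable def PHE.cipherDist {F : Type} [Field F] (E : PHE F) (l : ℕ) {k : ℕ}
    (m : Fin k → F) : PMF (List Bool) :=
  (PMF.uniformOfFintype (E.KeyCoin l × (Fin k → E.EncCoin l))).map fun ω =>
    (E.pkCode l).code (E.pk l ω.1) ++
      concat fun i => (E.ctCode l).code (E.enc l (E.pk l ω.1) (m i) (ω.2 i))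

/-- Semantic security (for several messages): given the public key, encryptions of any two
sequences of messages of the same length are indistinguishable. -/
def PHE.IsSecure {F : Type} [Field F] (E : PHE F) : Prop :=
  ∀ (k : ℕ) (m m' : ℕ → Fin k → F),
    CompIndist (fun l => E.cipherDist l (m l)) (fun l => E.cipherDist l (m' l))

/-- A protocol by which `N` clients with subsets of `U` compute the union of these sets. In each
of finitely many synchronous rounds, each client sends to each client a vector over `F` that is
computed from its set, its coins and the vectors it received in the earlier rounds. -/
structure UnionProtocol (F U : Type) [DecidableEq U] (N : ℕ) where
  Coin : ℕ → Type
  [coinFintype : ∀ l, Fintype (Coin l)]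
  [coinNonempty : ∀ l, Nonempty (Coin l)]
  rounds : ℕ → ℕ
  len : ℕ → ℕ
  polyBounded : PolyBounded fun l => rounds l * len l
  send : ∀ l, Fin N → Finset U → Coin l → List (Fin N → Fin (len l) → F) →
    Fin N → Fin (len l) → F
  output : ∀ l, Fin N → Finset U → Coin l → List (Fin N → Fin (len l) → F) → Finset U

attribute [instance] UnionProtocol.coinFintype UnionProtocol.coinNonempty

section Union

variable {F U : Type} [DecidableEq U] {N : ℕ} (P : UnionProtocol F U N) (l : ℕ)

/-- The vectors received by client `n` in the first `k` rounds. -/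
def UnionProtocol.received (E : Fin N → Finset U) (ω : Fin N → P.Coin l) :
    ℕ → Fin N → List (Fin N → Fin (P.len l) → F)
  | 0, _ => []
  | k + 1, n => UnionProtocol.received E ω k n ++
      [fun v => P.send l v (E v) (ω v) (UnionProtocol.received E ω k v) n]

/-- The vector that client `n` sends to client `v` in round `k`. -/
def UnionProtocol.sent (E : Fin N → Finset U) (ω : Fin N → P.Coin l) (k : ℕ) (n v : Fin N) :
    Fin (P.len l) → F :=
  P.send l n (E n) (ω n) (P.received l E ω k n) v

/-- Every client always obtains the union of all sets. -/
def UnionProtocol.IsCorrect : Prop :=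
  ∀ l (E : Fin N → Finset U) (ω : Fin N → P.Coin l) (n : Fin N),
    P.output l n (E n) (ω n) (P.received l E ω (P.rounds l) n) = Finset.univ.biUnion E

/-- What the coalition `𝒯` sees: its coins and all vectors it receives. -/
noncomputable def UnionProtocol.coalitionDist (E : Fin N → Finset U) (𝒯 : Finset (Fin N)) :
    PMF (𝒯 → P.Coin l × List (Fin N → Fin (P.len l) → F)) :=
  (PMF.uniformOfFintype (Fin N → P.Coin l)).map fun ω n =>
    (ω n, P.received l E ω (P.rounds l) n)

/-- Statistical privacy against coalitions of up to `T` clients: beyond its own sets and the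
union of all sets, a coalition learns nothing. -/
def UnionProtocol.IsPrivate (T : ℕ) : Prop :=
  ∀ 𝒯 : Finset (Fin N), 𝒯.card ≤ T → ∀ E E' : Fin N → Finset U,
    (∀ n ∈ 𝒯, E n = E' n) → Finset.univ.biUnion E = Finset.univ.biUnion E' →
    StatIndist (fun l => P.coalitionDist l E 𝒯) (fun l => P.coalitionDist l E' 𝒯)

end Union

/-! ### Parameters of the protocol -/

/-- The partitioning parameter. -/
def partK (N T : ℕ) : ℕ := (N + 1) / 2 - T

/-- `N` clients, privacy threshold `T < N / 2`, embeddings of length `d`, sub-vectors of length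
`s = (d + 1) / K`, and pairwise distinct interpolation points `α`, `β` in the field, in which the
numbers `1, …, N` have inverses. -/
structure Params (F : Type) [Field F] where
  N : ℕ
  T : ℕ
  d : ℕ
  s : ℕ
  two_mul_T_lt : 2 * T < N
  K_mul_s : partK N T * s = d + 1
  α : Fin N → F
  β : Fin (partK N T + T) → F
  α_injective : Function.Injective α
  β_injective : Function.Injective β
  α_ne_β : ∀ n k, α n ≠ β k
  natCast_ne_zero : ∀ k : ℕ, 1 ≤ k → k ≤ N → (k : F) ≠ 0

section Params

variable {F : Type} [Field F] (p : Params F)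

abbrev Params.K : ℕ := partK p.N p.T

/-- The number of noise vectors of the server per response. -/
abbrev Params.Kt : ℕ := p.K + 2 * p.T - 1

lemma Params.Kt_le : p.Kt ≤ p.N := by
  have := p.two_mul_T_lt
  simp only [Params.Kt, Params.K, partK]
  omega

end Params

/-- The three uses of pairwise one-time pads: union, sharing, queries. -/
inductive Phase where
  | union
  | share
  | query
  deriving DecidableEq

instance : Fintype Phase := ⟨{.union, .share, .query}, fun a => by cases a <;> decide⟩

/-- The primitives the protocol is run with. -/
structure Primitives (F U : Type) [Field F] [DecidableEq U] (N : ℕ) where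
  psu : UnionProtocol F U N
  psu_correct : psu.IsCorrect
  prg : PRG F
  kex : KeyExchange prg.Seed
  phe : PHE F

/-! ### Inputs and the ideal result -/

section Inputs

variable {F U : Type} [Field F] [Fintype U] [LinearOrder U] {p : Params F}

/-- The inputs: `x n e = some h` if client `n` has the entity `e`, with local embedding `h`, and
`x n e = none` if it does not have `e`. -/
abbrev Inputs (U : Type) {F : Type} [Field F] (p : Params F) : Type :=
  Fin p.N → U → Option (Fin p.d → F)

/-- The entity set of client `n`. -/
def entities (x : Inputs U p) (n : Fin p.N) : Finset U := {e | (x n e).isSome}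

/-- The union of all entity sets. -/
def entityUnion (x : Inputs U p) : Finset U := Finset.univ.biUnion (entities x)

/-- The average of the embeddings of `e` over exactly the clients that have `e`. -/
def average (x : Inputs U p) (e : U) : Fin p.d → F := fun i =>
  (∑ v with e ∈ entities x v, (x v e).getD 0 i) /
    (((Finset.univ.filter fun v => e ∈ entities x v).card : ℕ) : F)

/-- The number of entities in the union. -/
abbrev numEntities (x : Inputs U p) : ℕ := (entityUnion x).card

/-- The `m`-th entity in the union. -/
def unionEntity (x : Inputs U p) (m : Fin (numEntities x)) : U :=
  (entityUnion x).orderEmbOfFin rfl m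

/-- The number of entities of client `n`. -/
abbrev numLocal (x : Inputs U p) (n : Fin p.N) : ℕ := (entities x n).card

/-- The `j`-th entity of client `n`. -/
def localEntity (x : Inputs U p) (n : Fin p.N) (j : Fin (numLocal x n)) : U :=
  (entities x n).orderEmbOfFin rfl j

/-- The position of `j` among all possible numbers of a query. -/
def slot (x : Inputs U p) (n : Fin p.N) (j : Fin (numLocal x n)) : Fin (Fintype.card U) :=
  Fin.castLE (Finset.card_le_univ _) j

/-- The expanded embedding: `(h, 1)` if client `n` has `e` with embedding `h`, and `0` if not. -/
def expanded (x : Inputs U p) (n : Fin p.N) (e : U) : Fin (p.d + 1) → F :=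
  match x n e with
  | some h => Fin.snoc h 1
  | none => 0

/-- Coordinate `c` of the `k`-th of `K` consecutive sub-vectors of length `s`. -/
def partIndex (p : Params F) (k : Fin p.K) (c : Fin p.s) : Fin (p.d + 1) :=
  Fin.cast p.K_mul_s (finProdFinEquiv (k, c))

end Inputs

/-! ### The protocol -/

section Protocol

variable {F U : Type} [Field F] [Fintype F] [Fintype U] [LinearOrder U]
variable (p : Params F) (S : Primitives F U p.N) (l : ℕ)

/-- The coins of a client. -/
structure ClientCoins where
  /-- coins of the union protocol -/
  union : S.psu.Coin l
  /-- key exchange secrets for the pads of messages to each client -/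
  sendSecret : Phase → Fin p.N → S.kex.Secret l
  /-- key exchange secrets for the pads of messages from each client -/
  recvSecret : Phase → Fin p.N → S.kex.Secret l
  /-- noise of the secret sharing, for each entity -/
  shareNoise : U → Fin p.T → Fin p.s → F
  /-- noise of the query for an entity (first argument) -/
  queryNoise : U → U → Fin p.T → F
  /-- coins for the key pair of the homomorphic encryption -/
  keyCoin : S.phe.KeyCoin l
  /-- coins for encrypting the answer to the `j`-th query of each client -/
  encCoin : Fin p.N → Fin (Fintype.card U) → Fin p.s → S.phe.EncCoin l

/-- The coins of the server, for the `j`-th query of each client. -/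
structure ServerCoins where
  /-- the multiplicative mask, a nonzero field element -/
  mask : Fin p.N → Fin (Fintype.card U) → Fˣ
  /-- the noise vectors -/
  noise : Fin p.N → Fin (Fintype.card U) → Fin p.Kt → Fin p.s → F
  /-- coins for encrypting the noise that is added to the answer of client `v` (first argument) -/
  encCoin : Fin p.N → Fin p.N → Fin (Fintype.card U) → Fin p.s → S.phe.EncCoin l

noncomputable instance : Fintype (ClientCoins p S l) :=
  have : Finite (ClientCoins p S l) := Finite.of_injective
    (fun c => (c.union, c.sendSecret, c.recvSecret, c.shareNoise, c.queryNoise, c.keyCoin,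
      c.encCoin))
    (fun a b h => by cases a; cases b; simpa using h)
  Fintype.ofFinite _

instance : Nonempty (ClientCoins p S l) :=
  ⟨⟨Classical.arbitrary _, Classical.arbitrary _, Classical.arbitrary _, 0, 0,
    Classical.arbitrary _, Classical.arbitrary _⟩⟩

noncomputable instance : Fintype (ServerCoins p S l) :=
  have : Finite Fˣ := Finite.of_injective Units.val Units.val_injective
  have : Finite (ServerCoins p S l) := Finite.of_injective
    (fun c => (c.mask, c.noise, c.encCoin))
    (fun a b h => by cases a; cases b; simpa using h)
  Fintype.ofFinite _

instance : Nonempty (ServerCoins p S l) :=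
  ⟨⟨Classical.arbitrary _, 0, Classical.arbitrary _⟩⟩

/-- All coins of an execution; they are drawn uniformly and independently. -/
abbrev Coins : Type := (Fin p.N → ClientCoins p S l) × ServerCoins p S l

variable {p S l}
variable (x : Inputs U p) (ω : Coins p S l)

/-! #### Pairwise one-time pads -/

/-- The public key exchange message of the sender `n`, for messages from `n` to `v`. -/
def sendPub (a : Phase) (n v : Fin p.N) : S.kex.Pub l := S.kex.pub l ((ω.1 n).sendSecret a v)

/-- The public key exchange message of the receiver `v`, for messages from `n` to `v`. -/
def recvPub (a : Phase) (n v : Fin p.N) : S.kex.Pub l := S.kex.pub l ((ω.1 v).recvSecret a n)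

/-- The pad for messages from `n` to `v`, as computed by the sender `n`. -/
def sendPad (a : Phase) (n v : Fin p.N) : ℕ → F :=
  S.prg.gen l (S.kex.key l ((ω.1 n).sendSecret a v) (recvPub ω a n v))

/-- The pad for messages from `n` to `v`, as computed by the receiver `v`. -/
def recvPad (a : Phase) (n v : Fin p.N) : ℕ → F :=
  S.prg.gen l (S.kex.key l ((ω.1 v).recvSecret a n) (sendPub ω a n v))

/-- One-time-pad encryption. -/
def padEnc {k : ℕ} (pad : ℕ → F) (y : Fin k → F) : Fin k → F := fun i => y i + pad i

/-- One-time-pad decryption. -/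
def padDec {k : ℕ} (pad : ℕ → F) (y : Fin k → F) : Fin k → F := fun i => y i - pad i

/-! #### Private entity union -/

/-- The masked messages of the union protocol from `n` to `v`, all rounds in a row. After this
phase, all clients and the server know `entityUnion x`. -/
def unionWire (n v : Fin p.N) : Fin (S.psu.rounds l * S.psu.len l) → F :=
  padEnc (sendPad ω .union n v) fun i =>
    S.psu.sent l (entities x) (fun u => (ω.1 u).union) (finProdFinEquiv.symm i).1 n v
      (finProdFinEquiv.symm i).2

/-! #### Private embedding sharing -/

/-- Coordinate `c` of the sharing polynomial of client `n` for the entity `e`. -/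
noncomputable def sharePoly (n : Fin p.N) (e : U) (c : Fin p.s) : Polynomial F :=
  Lagrange.interpolate Finset.univ p.β
    (Fin.append (fun k : Fin p.K => expanded x n e (partIndex p k c))
      (fun t => (ω.1 n).shareNoise e t c))

/-- The masked shares sent from `n` to `v` (through the server). -/
noncomputable def shareWire (n v : Fin p.N) : Fin (numEntities x * p.s) → F :=
  padEnc (sendPad ω .share n v) fun i =>
    (sharePoly x ω n (unionEntity x (finProdFinEquiv.symm i).1) (finProdFinEquiv.symm i).2).eval
      (p.α v)

/-- The aggregated shares of client `v`, after decryption. -/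
noncomputable def aggShare (v : Fin p.N) (m : Fin (numEntities x)) (c : Fin p.s) : F :=
  ∑ n, padDec (recvPad ω .share n v) (shareWire x ω n v) (finProdFinEquiv (m, c))

/-! #### Private embedding aggregation retrieval -/

/-- The query polynomial of client `n` for its entity `e`, belonging to the entity `e'`. -/
noncomputable def queryPoly (n : Fin p.N) (e e' : U) : Polynomial F :=
  Lagrange.interpolate Finset.univ p.β
    (Fin.append (fun _ : Fin p.K => if e' = e then 1 else 0)
      (fun t => (ω.1 n).queryNoise e e' t))

/-- The masked queries sent from `n` to `v` (through the server), one after the other for all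
entities of `n`. -/
noncomputable def queryWire (n v : Fin p.N) : Fin (numLocal x n * numEntities x) → F :=
  padEnc (sendPad ω .query n v) fun i =>
    (queryPoly ω n (localEntity x n (finProdFinEquiv.symm i).1)
      (unionEntity x (finProdFinEquiv.symm i).2)).eval (p.α v)

/-- The answer of client `v` to the `j`-th query of client `n`. -/
noncomputable def answer (v n : Fin p.N) (j : Fin (numLocal x n)) (c : Fin p.s) : F :=
  ∑ m, padDec (recvPad ω .query n v) (queryWire x ω n v) (finProdFinEquiv (j, m)) *
    aggShare x ω v m c

/-- The public key of client `n`. -/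
def publicKey (n : Fin p.N) : S.phe.PK l := S.phe.pk l (ω.1 n).keyCoin

/-- The encrypted answer that client `v` sends to the server. -/
noncomputable def encAnswer (v n : Fin p.N) (j : Fin (numLocal x n)) (c : Fin p.s) :
    S.phe.CT l :=
  S.phe.enc l (publicKey ω n) (answer x ω v n j c) ((ω.1 v).encCoin n (slot x n j) c)

/-- The noise polynomial of the server for the query in the given slot of client `n`. -/
noncomputable def noisePoly (n : Fin p.N) (i : Fin (Fintype.card U)) (c : Fin p.s) :
    Polynomial F :=
  Lagrange.interpolate (Finset.univ : Finset (Fin p.K ⊕ Fin p.Kt))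
    (Sum.elim (fun k => p.β (Fin.castAdd p.T k)) (fun k => p.α (Fin.castLE p.Kt_le k)))
    (Sum.elim (fun _ => 0) (fun k => ω.2.noise n i k c))

/-- The ciphertext that the server sends to client `n`, from the answer of client `v`. -/
noncomputable def response (v n : Fin p.N) (j : Fin (numLocal x n)) (c : Fin p.s) :
    S.phe.CT l :=
  S.phe.mul l (publicKey ω n)
    (S.phe.pow l (publicKey ω n) (encAnswer x ω v n j c) (ω.2.mask n (slot x n j)))
    (S.phe.enc l (publicKey ω n) ((noisePoly ω n (slot x n j) c).eval (p.α v))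
      (ω.2.encCoin v n (slot x n j) c))

/-- The vector of length `d + 1` that client `n` gets by decryption, interpolation, and
evaluation of the response polynomial. -/
noncomputable def decoded (n : Fin p.N) (j : Fin (numLocal x n)) (i : Fin (p.d + 1)) : F :=
  let kc := finProdFinEquiv.symm (Fin.cast p.K_mul_s.symm i)
  (Lagrange.interpolate Finset.univ p.α fun v =>
    S.phe.dec l (S.phe.sk l (ω.1 n).keyCoin) (response x ω v n j kc.2)).eval
      (p.β (Fin.castAdd p.T kc.1))

/-- The embedding that client `n` finally computes for the entity `e`, if it has this entity. -/
noncomputable def output (n : Fin p.N) (e : U) : Option (Fin p.d → F) :=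
  if he : e ∈ entities x n then
    let j : Fin (numLocal x n) := ((entities x n).orderIsoOfFin rfl).symm ⟨e, he⟩
    some fun i => decoded x ω n j i.castSucc / decoded x ω n j (Fin.last p.d)
  else none

/-! #### What the parties see -/

variable (p S l) in
/-- The view of a client: its input, its coins, and all that it receives. -/
structure ClientView where
  input : U → Option (Fin p.d → F)
  coins : ClientCoins p S l
  union : Finset U
  pubFromSender : Phase → Fin p.N → S.kex.Pub l
  pubFromReceiver : Phase → Fin p.N → S.kex.Pub l
  publicKeys : Fin p.N → S.phe.PK l
  unionMsgs : Fin p.N → List F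
  shares : Fin p.N → List F
  queries : Fin p.N → List F
  responses : Fin p.N → List (Fin p.s → S.phe.CT l)

/-- The view of client `n`. -/
noncomputable def clientView (n : Fin p.N) : ClientView p S l where
  input := x n
  coins := ω.1 n
  union := entityUnion x
  pubFromSender := fun a v => sendPub ω a v n
  pubFromReceiver := fun a v => recvPub ω a n v
  publicKeys := publicKey ω
  unionMsgs := fun v => List.ofFn (unionWire x ω v n)
  shares := fun v => List.ofFn (shareWire x ω v n)
  queries := fun v => List.ofFn (queryWire x ω v n)
  responses := fun v => List.ofFn fun j => response x ω v n j

/-- The view of client `n`, without the messages of the union protocol. -/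
noncomputable def laterView (n : Fin p.N) : ClientView p S l :=
  { clientView x ω n with unionMsgs := fun _ => [] }

variable (S l) in
/-- The distribution of the joint view of the coalition `𝒯`. -/
noncomputable def coalitionDist (𝒯 : Finset (Fin p.N)) : PMF (𝒯 → ClientView p S l) :=
  (PMF.uniformOfFintype (Coins p S l)).map fun ω n => clientView x ω n

variable (S l) in
/-- The same, without the messages of the union protocol. -/
noncomputable def laterCoalitionDist (𝒯 : Finset (Fin p.N)) : PMF (𝒯 → ClientView p S l) :=
  (PMF.uniformOfFintype (Coins p S l)).map fun ω n => laterView x ω n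

/-- The view of the server as a bit string: the union of the entity sets, all key exchange
messages, all public keys, all masked messages it relays, all encrypted answers, and its coins. -/
noncomputable def serverView (codeF : BitCode F) : List Bool :=
  ((Finset.univ : Finset U).sort (· ≤ ·)).map (fun e => decide (e ∈ entityUnion x)) ++
  [Phase.union, Phase.share, Phase.query].flatMap (fun a => concat fun n => concat fun v =>
    (S.kex.pubCode l).code (sendPub ω a n v) ++ (S.kex.pubCode l).code (recvPub ω a n v)) ++
  (concat fun n => (S.phe.pkCode l).code (publicKey ω n)) ++
  (concat fun n => concat fun v => concat fun i => codeF.code (unionWire x ω n v i)) ++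
  (concat fun n => concat fun v => concat fun i => codeF.code (shareWire x ω n v i)) ++
  (concat fun n => concat fun v => concat fun i => codeF.code (queryWire x ω n v i)) ++
  (concat fun v => concat fun n => concat fun j => concat fun c =>
    (S.phe.ctCode l).code (encAnswer x ω v n j c)) ++
  (concat fun n => concat fun i => codeF.code (ω.2.mask n i : F)) ++
  (concat fun n => concat fun i => concat fun k => concat fun c =>
    codeF.code (ω.2.noise n i k c)) ++
  (concat fun v => concat fun n => concat fun i => concat fun c =>
    (S.phe.encCoinCode l).code (ω.2.encCoin v n i c))

variable (S l) in
/-- The distribution of the view of the server. -/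
noncomputable def serverDist (codeF : BitCode F) : PMF (List Bool) :=
  (PMF.uniformOfFintype (Coins p S l)).map fun ω => serverView x ω codeF

end Protocol

/-! ### Correctness and privacy -/

section Goals

variable {F U : Type} [Field F] [Fintype F] [Fintype U] [LinearOrder U]

/-- In every execution, each client obtains, for each of its entities, the average of the local
embeddings over exactly the clients that have this entity. -/
def IsCorrect (p : Params F) (S : Primitives F U p.N) : Prop :=
  ∀ (l : ℕ) (x : Inputs U p) (ω : Coins p S l) (n : Fin p.N), ∀ e ∈ entities x n,
    output x ω n e = some (average x e)

/-- `x` and `x'` agree in what everybody may learn: the union of the entity sets, and the number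
of entities of each client. -/
def SamePublic {p : Params F} (x x' : Inputs U p) : Prop :=
  entityUnion x = entityUnion x' ∧ ∀ n, numLocal x n = numLocal x' n

/-- `x` and `x'` agree in what the coalition `𝒯` may learn: the public data, its own inputs, and
the average embeddings of its own entities. -/
def SameForCoalition {p : Params F} (𝒯 : Finset (Fin p.N)) (x x' : Inputs U p) : Prop :=
  SamePublic x x' ∧ (∀ n ∈ 𝒯, x n = x' n) ∧
    ∀ n ∈ 𝒯, ∀ e ∈ entities x n, average x e = average x' e

/-- Entity privacy and embedding privacy at once, against coalitions of up to `T` clients, in the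
statistical sense: which entities the other clients have and what their local embeddings are
makes no noticeable difference to the joint view. -/
def PrivateAgainstCoalitions (p : Params F) (S : Primitives F U p.N) : Prop :=
  ∀ 𝒯 : Finset (Fin p.N), 𝒯.card ≤ p.T → ∀ x x' : Inputs U p, SameForCoalition 𝒯 x x' →
    StatIndist (fun l => coalitionDist S l x 𝒯) (fun l => coalitionDist S l x' 𝒯)

/-- The same for all that follows the union protocol, in the perfect sense. -/
def PerfectlyPrivateAfterUnion (p : Params F) (S : Primitives F U p.N) : Prop :=
  ∀ 𝒯 : Finset (Fin p.N), 𝒯.card ≤ p.T → ∀ x x' : Inputs U p, SameForCoalition 𝒯 x x' →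
    ∀ l, laterCoalitionDist S l x 𝒯 = laterCoalitionDist S l x' 𝒯

/-- Entity privacy and embedding privacy at once, against the server, in the computational
sense. -/
def PrivateAgainstServer (p : Params F) (S : Primitives F U p.N) (codeF : BitCode F) : Prop :=
  ∀ x x' : Inputs U p, SamePublic x x' →
    CompIndist (fun l => serverDist S l x codeF) (fun l => serverDist S l x' codeF)

end Goals

end SecEA

/-!
Correctness is polynomial interpolation. What client `v` answers to a query is the value at `α v`
of a product of two polynomials of degree below `K + T`, and the response of the server is the
value of `r` times this product plus a noise polynomial (`respPoly`, `response_eq`). The degree of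
the response polynomial is below `2 K + 2 T - 1 ≤ N`, so the `N` responses determine it, and at
`β₁, …, β_K` it shows `r` times the number of holders times the average, expanded by a `1`
(`eval_respPoly_β`); the quotient by the last coordinate is the average.

Against a coalition, an explicit permutation of the coins turns an execution on one input into an
execution on the other with the same view after the union protocol
(`CoinTransport.laterView_coinMap`). Shares and queries are adjusted by translating the noise
(`exists_noise_shift`), together with a matching of the entities of each client. The response
polynomials agree if the mask is rescaled by the ratio of the numbers of holders and the noise at
the first `K + 2 T - 1` clients absorbs the rest (`respPoly_maskMap`), and the ciphertexts agree
because the homomorphic operations only permute the coins of the fresh encryption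
(`PHE.exists_perm_mul_pow`). Given the later views, the messages of the union protocol are a
function of the coalition's view of that protocol, so its statistical privacy carries over.

Against the server, a hybrid argument (`compIndist_hybrid`) replaces first the agreed keys by
random seeds, then the pads by uniform ones, and finally, as the masked messages are now uniform,
the encrypted answers by encryptions of zero. The resulting view (`idealDist`) depends only on the
union of the entity sets and their cardinalities. In each step all coins but those of the replaced
component are fixed in the best way; the remaining view is computed from that component by copying
bits, and by evaluating the generator and adding constants of `F` for the masked messages
(`computes_relayView`), so a distinguisher stays of polynomial size.
-/

namespace SecEA

open Finset
open scoped BigOperators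

set_option linter.unusedSectionVars false

/-! ### Uniform coins -/

section Uniform

/-- The probability of an event under a pushforward of uniform coins, as an average over the
coins. -/
lemma toOuterMeasure_map_uniform {Ω X : Type} [Fintype Ω] [Nonempty Ω] (f : Ω → X) (A : Set X) :
    (((PMF.uniformOfFintype Ω).map f).toOuterMeasure A).toReal =
      𝔼 ω, A.indicator (fun _ => (1 : ℝ)) (f ω) := by
  classical
  rw [PMF.toOuterMeasure_map_apply, PMF.toOuterMeasure_uniformOfFintype_apply,
    Fintype.expect_eq_sum_div_card, ENNReal.toReal_div]
  simp [Set.indicator_apply, Fintype.card_subtype]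

lemma map_uniform_apply_toReal {Ω X : Type} [Fintype Ω] [Nonempty Ω] [DecidableEq X]
    (f : Ω → X) (b : X) :
    (((PMF.uniformOfFintype Ω).map f) b).toReal = 𝔼 ω, if f ω = b then (1 : ℝ) else 0 := by
  rw [← PMF.toOuterMeasure_apply_singleton, toOuterMeasure_map_uniform]
  simp [Set.indicator_apply]

/-- Two functions of uniform coins with the same distribution differ by a permutation of the
coins: corresponding fibres have the same size. -/
lemma exists_perm_of_map_uniform_eq {Ω X : Type} [Fintype Ω] [Nonempty Ω] {f g : Ω → X}
    (h : (PMF.uniformOfFintype Ω).map f = (PMF.uniformOfFintype Ω).map g) :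
    ∃ π : Equiv.Perm Ω, ∀ ω, f ω = g (π ω) := by
  classical
  have hc : ∀ b, Fintype.card {a // f a = b} = Fintype.card {a // g a = b} := by
    intro b
    have h1 := congrArg (fun P : PMF X => (P b).toReal) h
    simp only [map_uniform_apply_toReal, Fintype.expect_eq_sum_div_card] at h1
    have h2 : (Fintype.card Ω : ℝ) ≠ 0 := by positivity
    rw [div_left_inj' h2] at h1
    rw [Fintype.card_subtype, Fintype.card_subtype]
    simpa using h1
  have e : ∀ b, {a // f a = b} ≃ {a // g a = b} := fun b => Fintype.equivOfCardEq (hc b)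
  refine ⟨(Equiv.sigmaFiberEquiv f).symm.trans
    ((Equiv.sigmaCongrRight e).trans (Equiv.sigmaFiberEquiv g)), fun ω => ?_⟩
  exact (e (f ω) ⟨ω, rfl⟩).2.symm

lemma map_uniform_eq_of_bijective {Ω Ω' X : Type} [Fintype Ω] [Nonempty Ω] [Fintype Ω']
    [Nonempty Ω'] {f : Ω → X} {g : Ω' → X} (σ : Ω → Ω') (hσ : Function.Bijective σ)
    (h : ∀ ω, f ω = g (σ ω)) :
    (PMF.uniformOfFintype Ω).map f = (PMF.uniformOfFintype Ω').map g := by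
  classical
  refine PMF.ext fun b => ?_
  rw [← ENNReal.toReal_eq_toReal_iff' (PMF.apply_ne_top _ _) (PMF.apply_ne_top _ _),
    map_uniform_apply_toReal, map_uniform_apply_toReal]
  exact Fintype.expect_bijective σ hσ _ _ fun ω => by rw [h]

/-- Uniform coins stay uniform if one component, which `get` reads and `set` overwrites, is drawn
afresh. -/
lemma expect_resample {A B : Type} [Fintype A] [Fintype B] (get : A → B)
    (set : B → A → A) (set_get : ∀ a, set (get a) a = a) (get_set : ∀ b a, get (set b a) = b)
    (set_set : ∀ b b' a, set b (set b' a) = set b a) (φ : A → ℝ) :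
    𝔼 a, φ a = 𝔼 a, 𝔼 b, φ (set b a) := by
  rw [← Finset.expect_product' univ univ (fun a b => φ (set b a)), Finset.univ_product_univ]
  have hinv : Function.Involutive fun q : A × B => (set q.2 q.1, get q.1) := by
    rintro ⟨a, b⟩
    simp [set_set, get_set, set_get]
  rw [Fintype.expect_bijective _ hinv.bijective (fun q : A × B => φ (set q.2 q.1))
    (fun q => φ q.1) fun _ => rfl, ← Finset.univ_product_univ,
    Finset.expect_product' univ univ (fun a (_ : B) => φ a)]
  by_cases hA : Nonempty A
  · obtain ⟨a₀⟩ := hA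
    have : Nonempty B := ⟨get a₀⟩
    simp
  · have := not_nonempty_iff.1 hA
    simp

/-- Some coin is at least as good as the average. -/
lemma exists_abs_expect_sub_le {R : Type} [Fintype R] [Nonempty R] (a b : R → ℝ) :
    ∃ r, |𝔼 r, a r - 𝔼 r, b r| ≤ |a r - b r| := by
  rw [← Finset.expect_sub_distrib]
  obtain ⟨r, -, hr⟩ := Finset.exists_le_of_le_expect (f := fun r => |a r - b r|)
    Finset.univ_nonempty (Finset.abs_expect_le univ fun r => a r - b r)
  exact ⟨r, hr⟩

end Uniform

/-! ### The response polynomial and correctness -/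

section Decoding

open Polynomial

variable {F U : Type} [Field F]

lemma padDec_padEnc {k : ℕ} (pad : ℕ → F) (y : Fin k → F) : padDec pad (padEnc pad y) = y := by
  funext i
  simp [padDec, padEnc]

/-- The homomorphic operations turn a ciphertext of `m` into a ciphertext of `r * m + m₂`, whose
coins are a permutation of the coins of the fresh encryption of `m₂`. -/
lemma PHE.exists_perm_mul_pow (E : PHE F) (l : ℕ) (κ : E.KeyCoin l) (m : F) (ρ : E.EncCoin l)
    (r m₂ : F) : ∃ π : Equiv.Perm (E.EncCoin l), ∀ ρ₂,
      E.mul l (E.pk l κ) (E.pow l (E.pk l κ) (E.enc l (E.pk l κ) m ρ) r)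
        (E.enc l (E.pk l κ) m₂ ρ₂) = E.enc l (E.pk l κ) (r * m + m₂) (π ρ₂) := by
  obtain ⟨ρ', hρ'⟩ := E.enc_pow l κ m ρ r
  obtain ⟨π, hπ⟩ := exists_perm_of_map_uniform_eq (E.enc_mul l κ (r * m) m₂ ρ')
  exact ⟨π, fun ρ₂ => by rw [hρ', hπ]⟩

/-- The permutation of the server's encryption coins given by `PHE.exists_perm_mul_pow`. -/
noncomputable def PHE.freshPerm (E : PHE F) (l : ℕ) (κ : E.KeyCoin l) (m : F) (ρ : E.EncCoin l)
    (r m₂ : F) : Equiv.Perm (E.EncCoin l) :=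
  (E.exists_perm_mul_pow l κ m ρ r m₂).choose

lemma PHE.mul_pow_eq (E : PHE F) (l : ℕ) (κ : E.KeyCoin l) (m : F) (ρ : E.EncCoin l)
    (r m₂ : F) (ρ₂ : E.EncCoin l) :
    E.mul l (E.pk l κ) (E.pow l (E.pk l κ) (E.enc l (E.pk l κ) m ρ) r)
      (E.enc l (E.pk l κ) m₂ ρ₂) =
        E.enc l (E.pk l κ) (r * m + m₂) (E.freshPerm l κ m ρ r m₂ ρ₂) :=
  (E.exists_perm_mul_pow l κ m ρ r m₂).choose_spec ρ₂

variable [Fintype U] [LinearOrder U] {p : Params F}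

lemma Params.K_pos (p : Params F) : 0 < p.K := by
  have := p.two_mul_T_lt
  simp only [Params.K, partK]
  omega

lemma sum_unionEntity {M : Type*} [AddCommMonoid M] (x : Inputs U p) (f : U → M) :
    ∑ m, f (unionEntity x m) = ∑ e ∈ entityUnion x, f e := by
  rw [← Finset.sum_coe_sort (entityUnion x)]
  exact Fintype.sum_equiv ((entityUnion x).orderIsoOfFin rfl).toEquiv _ _ fun m => rfl

lemma mem_entities (x : Inputs U p) (n : Fin p.N) (e : U) :
    e ∈ entities x n ↔ (x n e).isSome := by simp [entities]

lemma mem_entityUnion_of_mem {x : Inputs U p} {n : Fin p.N} {e : U} (h : e ∈ entities x n) :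
    e ∈ entityUnion x :=
  Finset.mem_biUnion.2 ⟨n, Finset.mem_univ n, h⟩

/-- The number of clients that have `e`. -/
def numHolders (x : Inputs U p) (e : U) : ℕ :=
  (Finset.univ.filter fun v => e ∈ entities x v).card

lemma numHolders_ne_zero {x : Inputs U p} {n : Fin p.N} {e : U} (h : e ∈ entities x n) :
    (numHolders x e : F) ≠ 0 := by
  refine p.natCast_ne_zero _ (Finset.card_pos.2 ⟨n, by simpa using h⟩) ?_
  exact (Finset.card_le_univ _).trans (by simp)

lemma expanded_castSucc (x : Inputs U p) (n : Fin p.N) (e : U) (i : Fin p.d) :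
    expanded x n e i.castSucc = if e ∈ entities x n then (x n e).getD 0 i else 0 := by
  simp only [mem_entities, expanded]
  cases x n e <;> simp

lemma expanded_last (x : Inputs U p) (n : Fin p.N) (e : U) :
    expanded x n e (Fin.last p.d) = if e ∈ entities x n then 1 else 0 := by
  simp only [mem_entities, expanded]
  cases x n e <;> simp

lemma sum_expanded_last (x : Inputs U p) (e : U) :
    ∑ n, expanded x n e (Fin.last p.d) = numHolders x e := by
  simp_rw [expanded_last]
  rw [Finset.sum_boole]
  rfl

lemma sum_expanded_castSucc {x : Inputs U p} {e : U} (h : (numHolders x e : F) ≠ 0)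
    (i : Fin p.d) :
    ∑ n, expanded x n e i.castSucc = numHolders x e * average x e i := by
  have : average x e i = (∑ v with e ∈ entities x v, (x v e).getD 0 i) / (numHolders x e : F) :=
    rfl
  rw [this, mul_div_cancel₀ _ h, Finset.sum_filter]
  exact Finset.sum_congr rfl fun n _ => expanded_castSucc x n e i

/-- The expanded embeddings of `e` sum up to the number of holders times the average, expanded by
a `1`. -/
lemma sum_expanded {x : Inputs U p} {e : U} (h : (numHolders x e : F) ≠ 0)
    (i : Fin (p.d + 1)) :
    ∑ n, expanded x n e i =
      numHolders x e * (Fin.snoc (average x e) 1 : Fin (p.d + 1) → F) i := by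
  induction i using Fin.lastCases with
  | last => simp [sum_expanded_last]
  | cast i => simp [sum_expanded_castSucc h]

variable [Fintype F] {S : Primitives F U p.N} {l : ℕ} (x : Inputs U p) (ω : Coins p S l)

lemma recvPad_eq_sendPad (a : Phase) (n v : Fin p.N) : recvPad ω a n v = sendPad ω a n v := by
  unfold recvPad sendPad sendPub recvPub
  rw [S.kex.key_agree]

/-- The answers to the query of client `n` for `e` are the values of this polynomial. -/
noncomputable def ansPoly (n : Fin p.N) (e : U) (c : Fin p.s) : F[X] :=
  ∑ e' ∈ entityUnion x, queryPoly ω n e e' * ∑ n', sharePoly x ω n' e' c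

lemma aggShare_eq (v : Fin p.N) (m : Fin (numEntities x)) (c : Fin p.s) :
    aggShare x ω v m c = ∑ n, (sharePoly x ω n (unionEntity x m) c).eval (p.α v) := by
  unfold aggShare shareWire
  simp_rw [recvPad_eq_sendPad, padDec_padEnc]
  simp

lemma answer_eq (v n : Fin p.N) (j : Fin (numLocal x n)) (c : Fin p.s) :
    answer x ω v n j c = (ansPoly x ω n (localEntity x n j) c).eval (p.α v) := by
  unfold answer queryWire
  simp_rw [recvPad_eq_sendPad, padDec_padEnc, aggShare_eq]
  rw [ansPoly, ← sum_unionEntity]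
  simp [eval_finsetSum]

/-- The plaintexts of the responses to the query of client `n` for `e` in slot `i` are the values
of this polynomial. -/
noncomputable def respPoly (n : Fin p.N) (i : Fin (Fintype.card U)) (e : U) (c : Fin p.s) :
    F[X] :=
  C (ω.2.mask n i : F) * ansPoly x ω n e c + noisePoly ω n i c

lemma response_eq (v n : Fin p.N) (j : Fin (numLocal x n)) (c : Fin p.s) :
    response x ω v n j c = S.phe.enc l (publicKey ω n)
      ((respPoly x ω n (slot x n j) (localEntity x n j) c).eval (p.α v))
      (S.phe.freshPerm l (ω.1 n).keyCoin
        ((ansPoly x ω n (localEntity x n j) c).eval (p.α v))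
        ((ω.1 v).encCoin n (slot x n j) c) (ω.2.mask n (slot x n j))
        ((noisePoly ω n (slot x n j) c).eval (p.α v)) (ω.2.encCoin v n (slot x n j) c)) := by
  unfold response encAnswer publicKey
  rw [PHE.mul_pow_eq, answer_eq, respPoly]
  simp

/-- The nodes of the noise polynomials. -/
noncomputable def noiseNode (p : Params F) : Fin p.K ⊕ Fin p.Kt → F :=
  Sum.elim (fun k => p.β (Fin.castAdd p.T k)) (fun k => p.α (Fin.castLE p.Kt_le k))

lemma noiseNode_injective (p : Params F) : Function.Injective (noiseNode p) := by
  refine Function.Injective.sumElim ?_ ?_ ?_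
  · exact p.β_injective.comp (Fin.castAdd_injective _ _)
  · exact p.α_injective.comp (Fin.castLE_injective _)
  · exact fun a b => (p.α_ne_β _ _).symm

lemma card_noiseNode_le (p : Params F) :
    Fintype.card (Fin p.K ⊕ Fin p.Kt) ≤ p.N := by
  have := p.two_mul_T_lt
  rw [Fintype.card_sum, Fintype.card_fin, Fintype.card_fin]
  simp only [Params.Kt, Params.K, partK]
  omega

lemma natDegree_interpolate_β_le (f : Fin (partK p.N p.T + p.T) → F) :
    (Lagrange.interpolate Finset.univ p.β f).natDegree ≤ p.K + p.T - 1 := by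
  have h := Lagrange.degree_interpolate_lt f (s := Finset.univ) p.β_injective.injOn
  have hK := p.K_pos
  rw [Finset.card_univ, Fintype.card_fin] at h
  by_cases h0 : Lagrange.interpolate Finset.univ p.β f = 0
  · simp [h0]
  · rw [← Polynomial.natDegree_lt_iff_degree_lt h0] at h
    exact Nat.le_sub_one_of_lt h

lemma natDegree_ansPoly_le (n : Fin p.N) (e : U) (c : Fin p.s) :
    (ansPoly x ω n e c).natDegree ≤ (p.K + p.T - 1) + (p.K + p.T - 1) := by
  refine natDegree_sum_le_of_forall_le _ _ fun e' _ => ?_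
  refine natDegree_mul_le_of_le (natDegree_interpolate_β_le _) ?_
  exact natDegree_sum_le_of_forall_le _ _ fun n' _ => natDegree_interpolate_β_le _

lemma degree_noisePoly_lt (n : Fin p.N) (i : Fin (Fintype.card U)) (c : Fin p.s) :
    (noisePoly ω n i c).degree < (Fintype.card (Fin p.K ⊕ Fin p.Kt) : ℕ) :=
  Lagrange.degree_interpolate_lt _ (s := Finset.univ) (noiseNode_injective p).injOn

lemma degree_respPoly_lt (n : Fin p.N) (i : Fin (Fintype.card U)) (e : U) (c : Fin p.s) :
    (respPoly x ω n i e c).degree < (Fintype.card (Fin p.K ⊕ Fin p.Kt) : ℕ) := by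
  refine (degree_add_le _ _).trans_lt (max_lt ?_ (degree_noisePoly_lt ω n i c))
  refine (degree_le_natDegree).trans_lt ?_
  have h := (natDegree_C_mul_le (ω.2.mask n i : F) _).trans (natDegree_ansPoly_le x ω n e c)
  have hK := p.K_pos
  have : p.K + p.Kt = p.K + (p.K + 2 * p.T - 1) := rfl
  rw [Fintype.card_sum, Fintype.card_fin, Fintype.card_fin]
  exact_mod_cast h.trans_lt (by omega)

lemma eval_noisePoly_β (n : Fin p.N) (i : Fin (Fintype.card U)) (c : Fin p.s) (k : Fin p.K) :
    (noisePoly ω n i c).eval (p.β (Fin.castAdd p.T k)) = 0 := by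
  have := Lagrange.eval_interpolate_at_node
    (Sum.elim (fun _ => 0) (fun k => ω.2.noise n i k c)) (s := Finset.univ)
    (noiseNode_injective p).injOn (Finset.mem_univ (Sum.inl k))
  exact this

lemma eval_noisePoly_α (n : Fin p.N) (i : Fin (Fintype.card U)) (c : Fin p.s) (k : Fin p.Kt) :
    (noisePoly ω n i c).eval (p.α (Fin.castLE p.Kt_le k)) = ω.2.noise n i k c := by
  have := Lagrange.eval_interpolate_at_node
    (Sum.elim (fun _ => 0) (fun k => ω.2.noise n i k c)) (s := Finset.univ)
    (noiseNode_injective p).injOn (Finset.mem_univ (Sum.inr k))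
  exact this

lemma eval_sharePoly_β (n : Fin p.N) (e : U) (c : Fin p.s) (k : Fin p.K) :
    (sharePoly x ω n e c).eval (p.β (Fin.castAdd p.T k)) = expanded x n e (partIndex p k c) := by
  unfold sharePoly
  rw [Lagrange.eval_interpolate_at_node _ p.β_injective.injOn (Finset.mem_univ _),
    Fin.append_left]

lemma eval_queryPoly_β (n : Fin p.N) (e e' : U) (k : Fin p.K) :
    (queryPoly ω n e e').eval (p.β (Fin.castAdd p.T k)) = if e' = e then 1 else 0 := by
  unfold queryPoly
  rw [Lagrange.eval_interpolate_at_node _ p.β_injective.injOn (Finset.mem_univ _),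
    Fin.append_left]

lemma eval_ansPoly_β {n : Fin p.N} {e : U} (he : e ∈ entities x n) (c : Fin p.s)
    (k : Fin p.K) :
    (ansPoly x ω n e c).eval (p.β (Fin.castAdd p.T k)) =
      ∑ n', expanded x n' e (partIndex p k c) := by
  unfold ansPoly
  simp only [eval_finsetSum, eval_mul, eval_sharePoly_β, eval_queryPoly_β]
  rw [Finset.sum_eq_single_of_mem e (mem_entityUnion_of_mem he)]
  · simp
  · intro e' _ h
    simp [h]

lemma eval_respPoly_β {n : Fin p.N} (i : Fin (Fintype.card U)) {e : U} (he : e ∈ entities x n)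
    (c : Fin p.s) (k : Fin p.K) :
    (respPoly x ω n i e c).eval (p.β (Fin.castAdd p.T k)) =
      ω.2.mask n i * (numHolders x e *
        (Fin.snoc (average x e) 1 : Fin (p.d + 1) → F) (partIndex p k c)) := by
  rw [respPoly, eval_add, eval_mul, eval_C, eval_ansPoly_β x ω he, eval_noisePoly_β, add_zero,
    sum_expanded (numHolders_ne_zero he)]

lemma localEntity_mem (n : Fin p.N) (j : Fin (numLocal x n)) :
    localEntity x n j ∈ entities x n :=
  Finset.orderEmbOfFin_mem _ _ _

lemma decoded_eq (n : Fin p.N) (j : Fin (numLocal x n)) (i : Fin (p.d + 1)) :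
    decoded x ω n j i = ω.2.mask n (slot x n j) * (numHolders x (localEntity x n j) *
      (Fin.snoc (average x (localEntity x n j)) 1 : Fin (p.d + 1) → F) i) := by
  obtain ⟨⟨k, c⟩, rfl⟩ : ∃ kc : Fin p.K × Fin p.s, partIndex p kc.1 kc.2 = i :=
    ⟨finProdFinEquiv.symm (Fin.cast p.K_mul_s.symm i), by
      simp only [partIndex, Prod.mk.eta, Equiv.apply_symm_apply, Fin.cast_cast, Fin.cast_eq_self]⟩
  have hdeg : (respPoly x ω n (slot x n j) (localEntity x n j) c).degree <
      ((Finset.univ : Finset (Fin p.N)).card : ℕ) := by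
    rw [Finset.card_univ, Fintype.card_fin]
    refine (degree_respPoly_lt x ω _ _ _ _).trans_le ?_
    exact_mod_cast card_noiseNode_le p
  rw [← eval_respPoly_β x ω _ (localEntity_mem x n j)]
  conv_rhs => rw [Lagrange.eq_interpolate p.α_injective.injOn hdeg]
  simp only [decoded, partIndex, Fin.cast_cast, Fin.cast_eq_self, Equiv.symm_apply_apply,
    response_eq, publicKey, S.phe.dec_enc]

/-- The multiplicative mask and the number of holders cancel in the quotient of the decoded
coordinates. -/
theorem isCorrect (p : Params F) (S : Primitives F U p.N) : IsCorrect p S := by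
  intro l x ω n e he
  have hj : localEntity x n (((entities x n).orderIsoOfFin rfl).symm ⟨e, he⟩) = e := by
    rw [localEntity, ← Finset.coe_orderIsoOfFin_apply, OrderIso.apply_symm_apply]
  simp only [output, he, dite_true, decoded_eq, hj, Fin.snoc_castSucc, Fin.snoc_last]
  congr 1
  funext i
  have h1 := numHolders_ne_zero he
  have h2 := (ω.2.mask n (slot x n (((entities x n).orderIsoOfFin rfl).symm ⟨e, he⟩))).ne_zero
  field_simp

end Decoding

/-! ### Privacy against coalitions -/

section Coalition

open Polynomial

variable {F U : Type} [Field F]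

/-- Secret sharing hides the secrets: a change of the `K` secrets from `a` to `b` can be
compensated by a translation of the noise, such that the shares of up to `T` clients stay the
same. -/
lemma exists_noise_shift (p : Params F) {𝒯 : Finset (Fin p.N)} (h𝒯 : 𝒯.card ≤ p.T)
    (a b : Fin p.K → F) : ∃ δ : Fin p.T → F, ∀ w, ∀ v ∈ 𝒯,
      (Lagrange.interpolate Finset.univ p.β (Fin.append b fun t => w t + δ t)).eval (p.α v) =
        (Lagrange.interpolate Finset.univ p.β (Fin.append a w)).eval (p.α v) := by
  set node : Fin p.K ⊕ 𝒯 → F :=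
    Sum.elim (fun k => p.β (Fin.castAdd p.T k)) (fun v => p.α v) with hnode
  have hinj : Function.Injective node := by
    refine Function.Injective.sumElim ?_ ?_ ?_
    · exact p.β_injective.comp (Fin.castAdd_injective _ _)
    · exact p.α_injective.comp Subtype.val_injective
    · exact fun a b => (p.α_ne_β _ _).symm
  -- `D` takes the difference of the secrets at the first `K` nodes and vanishes on the coalition.
  set D : F[X] := Lagrange.interpolate Finset.univ node
    (Sum.elim (fun k => b k - a k) (fun _ => 0)) with hD
  have hDβ : ∀ k, D.eval (p.β (Fin.castAdd p.T k)) = b k - a k := fun k =>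
    Lagrange.eval_interpolate_at_node (Sum.elim (fun k => b k - a k) (fun _ => 0))
      (s := Finset.univ) hinj.injOn (Finset.mem_univ (Sum.inl k))
  have hDα : ∀ v ∈ 𝒯, D.eval (p.α v) = 0 := fun v hv =>
    Lagrange.eval_interpolate_at_node (Sum.elim (fun k => b k - a k) (fun _ => 0))
      (s := Finset.univ) hinj.injOn (Finset.mem_univ (Sum.inr (⟨v, hv⟩ : 𝒯)))
  have hdeg : D.degree < ((Finset.univ : Finset (Fin (partK p.N p.T + p.T))).card : ℕ) := by
    refine (Lagrange.degree_interpolate_lt _ hinj.injOn).trans_le ?_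
    rw [Finset.card_univ, Finset.card_univ, Fintype.card_sum, Fintype.card_fin, Fintype.card_fin,
      Fintype.card_coe]
    exact_mod_cast Nat.add_le_add_left h𝒯 _
  refine ⟨fun t => D.eval (p.β (Fin.natAdd p.K t)), fun w v hv => ?_⟩
  have key : Fin.append b (fun t => w t + D.eval (p.β (Fin.natAdd p.K t))) =
      Fin.append a w + fun i => D.eval (p.β i) := by
    funext i
    induction i using Fin.addCases with
    | left k => simp [hDβ]
    | right t => simp
  rw [key, map_add, eval_add, ← Lagrange.eq_interpolate p.β_injective.injOn hdeg, hDα v hv,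
    add_zero]

lemma ofFn_congr_val {X : Type} {a b : ℕ} (h : a = b) {f : Fin a → X} {g : Fin b → X}
    (hfg : ∀ (i : Fin a) (j : Fin b), (i : ℕ) = j → f i = g j) : List.ofFn f = List.ofFn g := by
  subst h
  exact congrArg _ (funext fun i => hfg i i rfl)

variable [Fintype U] [LinearOrder U]

lemma orderEmbOfFin_congr {s s' : Finset U} (h : s = s') {a : Fin s.card} {b : Fin s'.card}
    (hab : (a : ℕ) = b) : s.orderEmbOfFin rfl a = s'.orderEmbOfFin rfl b := by
  subst h
  rw [Fin.ext hab]

/-- A permutation that matches the elements of two sets of the same size in order. -/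
lemma exists_perm_orderEmbOfFin (s s' : Finset U) (h : s.card = s'.card) :
    ∃ τ : Equiv.Perm U, ∀ (a : Fin s.card) (b : Fin s'.card), (a : ℕ) = b →
      τ (s'.orderEmbOfFin rfl b) = s.orderEmbOfFin rfl a := by
  let e : {u // u ∈ s'} ≃ {u // u ∈ s} :=
    (s'.orderIsoOfFin rfl).symm.toEquiv.trans ((finCongr h.symm).trans
      (s.orderIsoOfFin rfl).toEquiv)
  refine ⟨e.extendSubtype, fun a b hab => ?_⟩
  rw [e.extendSubtype_apply_of_mem _ (Finset.orderEmbOfFin_mem _ _ _)]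
  have h1 : (⟨s'.orderEmbOfFin rfl b, Finset.orderEmbOfFin_mem _ _ _⟩ : {u // u ∈ s'}) =
      s'.orderIsoOfFin rfl b := Subtype.ext rfl
  rw [h1]
  simp only [e, Equiv.trans_apply, RelIso.coe_fn_toEquiv, OrderIso.symm_apply_apply,
    Finset.coe_orderIsoOfFin_apply]
  congr 1
  exact Fin.ext hab.symm

variable {p : Params F}

/-- The entity of client `n` that the query in slot `i` is about; an arbitrary entity if the slot
is not used. -/
noncomputable def entityAt (x : Inputs U p) (n : Fin p.N) (i : Fin (Fintype.card U)) : U :=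
  if h : (i : ℕ) < numLocal x n then localEntity x n ⟨i, h⟩ else (Fintype.equivFin U).symm i

lemma entityAt_slot (x : Inputs U p) (n : Fin p.N) (j : Fin (numLocal x n)) :
    entityAt x n (slot x n j) = localEntity x n j := by
  simp [entityAt, slot]

lemma localEntity_congr {x x' : Inputs U p} {n : Fin p.N} (h : x n = x' n)
    {j : Fin (numLocal x n)} {j' : Fin (numLocal x' n)} (hj : (j : ℕ) = j') :
    localEntity x n j = localEntity x' n j' := by
  exact orderEmbOfFin_congr (by simp only [entities, h]) hj

lemma unionEntity_congr {x x' : Inputs U p} (h : entityUnion x = entityUnion x')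
    {m : Fin (numEntities x)} {m' : Fin (numEntities x')} (hm : (m : ℕ) = m') :
    unionEntity x m = unionEntity x' m' := by
  exact orderEmbOfFin_congr h hm

lemma expanded_congr {x x' : Inputs U p} {n : Fin p.N} (h : x n = x' n) (e : U) :
    expanded x n e = expanded x' n e := by
  simp only [expanded, h]

variable [Fintype F] {S : Primitives F U p.N} {l : ℕ}

/-- Data for the transport of the coins of an execution on `x` to an execution on `x'` with the
same view of the coalition `𝒯`: a matching of the entities of each client, translations of the
noise of the shares and queries, and ratios of the multiplicative masks. -/
structure CoinTransport (𝒯 : Finset (Fin p.N)) (x x' : Inputs U p) where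
  perm : Fin p.N → Equiv.Perm U
  share : Fin p.N → U → Fin p.s → Fin p.T → F
  query : Fin p.N → U → U → Fin p.T → F
  ratio : Fin p.N → Fin (Fintype.card U) → Fˣ
  perm_localEntity : ∀ n (a : Fin (numLocal x n)) (b : Fin (numLocal x' n)), (a : ℕ) = b →
    perm n (localEntity x' n b) = localEntity x n a
  eval_share : ∀ n e c w, ∀ v ∈ 𝒯,
    (Lagrange.interpolate Finset.univ p.β (Fin.append
      (fun k : Fin p.K => expanded x' n e (partIndex p k c))
        fun t => w t + share n e c t)).eval (p.α v) =
    (Lagrange.interpolate Finset.univ p.β (Fin.append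
      (fun k : Fin p.K => expanded x n e (partIndex p k c)) w)).eval (p.α v)
  eval_query : ∀ n e e' w, ∀ v ∈ 𝒯,
    (Lagrange.interpolate Finset.univ p.β (Fin.append
      (fun _ : Fin p.K => if e' = e then (1 : F) else 0)
        fun t => w t + query n e e' t)).eval (p.α v) =
    (Lagrange.interpolate Finset.univ p.β (Fin.append
      (fun _ : Fin p.K => if e' = perm n e then (1 : F) else 0) w)).eval (p.α v)
  ratio_mul : ∀ n i, (numHolders x (entityAt x n i) : F) ≠ 0 →
    (numHolders x' (entityAt x n i) : F) ≠ 0 →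
    (ratio n i : F) * numHolders x' (entityAt x n i) = numHolders x (entityAt x n i)

lemma exists_coinTransport {𝒯 : Finset (Fin p.N)} (h𝒯 : 𝒯.card ≤ p.T) {x x' : Inputs U p}
    (h : ∀ n, numLocal x n = numLocal x' n) : Nonempty (CoinTransport 𝒯 x x') := by
  have h1 : ∀ n, ∃ τ : Equiv.Perm U, ∀ (a : Fin (numLocal x n)) (b : Fin (numLocal x' n)),
      (a : ℕ) = b → τ (localEntity x' n b) = localEntity x n a := fun n =>
    exists_perm_orderEmbOfFin _ _ (h n)
  choose τ hτ using h1
  choose δ hδ using exists_noise_shift p h𝒯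
  have h2 : ∀ n i, ∃ u : Fˣ, (numHolders x (entityAt x n i) : F) ≠ 0 →
      (numHolders x' (entityAt x n i) : F) ≠ 0 →
      (u : F) * numHolders x' (entityAt x n i) = numHolders x (entityAt x n i) := by
    intro n i
    by_cases ha : (numHolders x (entityAt x n i) : F) = 0
    · exact ⟨1, fun h => absurd ha h⟩
    by_cases hb : (numHolders x' (entityAt x n i) : F) = 0
    · exact ⟨1, fun _ h => absurd hb h⟩
    · exact ⟨Units.mk0 _ (div_ne_zero ha hb), fun _ _ => div_mul_cancel₀ _ hb⟩
  choose u hu using h2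
  exact ⟨⟨τ, _, _, u, hτ, fun n e c w v hv => hδ _ _ w v hv,
    fun n e e' w v hv => hδ _ _ w v hv, hu⟩⟩

namespace CoinTransport

variable {𝒯 : Finset (Fin p.N)} {x x' : Inputs U p} (D : CoinTransport 𝒯 x x')

/-- The transport of the coins of the clients; the coalition keeps its coins. -/
def clientMap (a : Fin p.N → ClientCoins p S l) (n : Fin p.N) : ClientCoins p S l :=
  if n ∈ 𝒯 then a n else
    { a n with
      shareNoise := fun e t c => (a n).shareNoise e t c + D.share n e c t
      queryNoise := fun e e' t => (a n).queryNoise (D.perm n e) e' t + D.query n e e' t }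

lemma clientMap_injective :
    Function.Injective (D.clientMap : (Fin p.N → ClientCoins p S l) → _) := by
  intro a b h
  funext n
  have hn := congrFun h n
  unfold clientMap at hn
  split_ifs at hn with hT
  · exact hn
  · generalize a n = a at hn
    generalize b n = b at hn
    cases a
    cases b
    simp only [ClientCoins.mk.injEq] at hn ⊢
    obtain ⟨h1, h2, h3, h4, h5, h6, h7⟩ := hn
    refine ⟨h1, h2, h3, ?_, ?_, h6, h7⟩
    · funext e t c
      exact add_right_cancel (congrFun (congrFun (congrFun h4 e) t) c)
    · funext e e' t
      have := congrFun (congrFun (congrFun h5 ((D.perm n).symm e)) e') t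
      simpa using this

lemma sendSecret_clientMap (a : Fin p.N → ClientCoins p S l) (n : Fin p.N) :
    (D.clientMap a n).sendSecret = (a n).sendSecret := by
  unfold clientMap
  split_ifs <;> rfl

lemma recvSecret_clientMap (a : Fin p.N → ClientCoins p S l) (n : Fin p.N) :
    (D.clientMap a n).recvSecret = (a n).recvSecret := by
  unfold clientMap
  split_ifs <;> rfl

lemma keyCoin_clientMap (a : Fin p.N → ClientCoins p S l) (n : Fin p.N) :
    (D.clientMap a n).keyCoin = (a n).keyCoin := by
  unfold clientMap
  split_ifs <;> rfl

/-- The transport of the masks and the noise of the server. The noise absorbs the change of the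
answers at the first `Kt` clients. -/
noncomputable def maskMap (ω : Coins p S l) : Coins p S l :=
  (D.clientMap ω.1,
    { ω.2 with
      mask := fun n i => ω.2.mask n i * D.ratio n i
      noise := fun n i k c => ω.2.noise n i k c +
        ((ω.2.mask n i : F) * (ansPoly x ω n (entityAt x n i) c).eval
            (p.α (Fin.castLE p.Kt_le k)) -
          (ω.2.mask n i * D.ratio n i : F) *
            (ansPoly x' (D.clientMap ω.1, ω.2) n (entityAt x n i) c).eval
              (p.α (Fin.castLE p.Kt_le k))) })

/-- The permutation by which the encryption coins of the server enter the response of client `v`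
to the query of client `n` in slot `i` about `e`. -/
noncomputable def responsePerm (x : Inputs U p) (ω : Coins p S l) (v n : Fin p.N)
    (i : Fin (Fintype.card U)) (e : U) (c : Fin p.s) : Equiv.Perm (S.phe.EncCoin l) :=
  S.phe.freshPerm l (ω.1 n).keyCoin ((ansPoly x ω n e c).eval (p.α v)) ((ω.1 v).encCoin n i c)
    (ω.2.mask n i) ((noisePoly ω n i c).eval (p.α v))

/-- The transport of all coins. -/
noncomputable def coinMap (ω : Coins p S l) : Coins p S l :=
  ((D.maskMap ω).1,
    { (D.maskMap ω).2 with
      encCoin := fun v n i c =>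
        (responsePerm x' (D.maskMap ω) v n i (entityAt x n i) c).symm
          (responsePerm x ω v n i (entityAt x n i) c (ω.2.encCoin v n i c)) })

lemma coinMap_injective : Function.Injective (D.coinMap : Coins p S l → _) := by
  rintro ⟨a, m, w, ρ⟩ ⟨b, m', w', ρ'⟩ h
  obtain rfl : a = b := D.clientMap_injective (congrArg Prod.fst h)
  obtain rfl : m = m' := by
    funext n i
    have := congrArg (fun ω : Coins p S l => ω.2.mask n i) h
    exact mul_right_cancel this
  obtain rfl : w = w' := by
    funext n i k c
    have := congrArg (fun ω : Coins p S l => ω.2.noise n i k c) h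
    exact add_right_cancel this
  congr 2
  funext v n i c
  have := congrArg (fun ω : Coins p S l => ω.2.encCoin v n i c) h
  exact (responsePerm x (S := S) (l := l) (a, ⟨m, w, ρ⟩) v n i (entityAt x n i) c).injective
    ((responsePerm x' (S := S) (l := l) (D.maskMap (a, ⟨m, w, ρ⟩)) v n i
      (entityAt x n i) c).symm.injective this)

lemma eval_sharePoly_coinMap (hx : ∀ n ∈ 𝒯, x n = x' n) (ω : Coins p S l) (n : Fin p.N) (e : U)
    (c : Fin p.s) {v : Fin p.N} (hv : v ∈ 𝒯) :
    (sharePoly x' (D.coinMap ω) n e c).eval (p.α v) =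
      (sharePoly x ω n e c).eval (p.α v) := by
  by_cases hn : n ∈ 𝒯
  · have h1 : (D.coinMap ω).1 n = ω.1 n := if_pos hn
    simp only [sharePoly, h1, expanded_congr (hx n hn)]
  · have h1 : ((D.coinMap ω).1 n).shareNoise =
        fun e t c => (ω.1 n).shareNoise e t c + D.share n e c t := by
      change (D.clientMap ω.1 n).shareNoise = _
      simp [clientMap, hn]
    simp only [sharePoly, h1]
    exact D.eval_share n e c (fun t => (ω.1 n).shareNoise e t c) v hv

lemma eval_queryPoly_coinMap (hx : ∀ n ∈ 𝒯, x n = x' n) (ω : Coins p S l) (n : Fin p.N)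
    (e' : U) {j : Fin (numLocal x n)} {j' : Fin (numLocal x' n)} (hj : (j : ℕ) = j')
    {v : Fin p.N} (hv : v ∈ 𝒯) :
    (queryPoly (D.coinMap ω) n (localEntity x' n j') e').eval (p.α v) =
      (queryPoly ω n (localEntity x n j) e').eval (p.α v) := by
  by_cases hn : n ∈ 𝒯
  · have h1 : (D.coinMap ω).1 n = ω.1 n := if_pos hn
    simp only [queryPoly, h1, localEntity_congr (hx n hn) hj]
  · have h1 : ((D.coinMap ω).1 n).queryNoise =
        fun e e' t => (ω.1 n).queryNoise (D.perm n e) e' t + D.query n e e' t := by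
      change (D.clientMap ω.1 n).queryNoise = _
      simp [clientMap, hn]
    simp only [queryPoly, h1]
    rw [← D.perm_localEntity n j j' hj]
    exact D.eval_query n _ e' _ v hv

/-- The response polynomials agree, because they agree at `β₁, …, β_K`, where they show the
averages up to the masked numbers of holders, and at the first `Kt` clients. -/
lemma respPoly_maskMap (hx : ∀ n ∈ 𝒯, x n = x' n)
    (havg : ∀ n ∈ 𝒯, ∀ e ∈ entities x n, average x e = average x' e) (ω : Coins p S l)
    {n : Fin p.N} (hn : n ∈ 𝒯) (j : Fin (numLocal x n)) (c : Fin p.s) :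
    respPoly x' (D.maskMap ω) n (slot x n j) (localEntity x n j) c =
      respPoly x ω n (slot x n j) (localEntity x n j) c := by
  have he := localEntity_mem x n j
  have he' : localEntity x n j ∈ entities x' n := by
    rw [mem_entities, ← hx n hn, ← mem_entities]
    exact he
  refine eq_of_degrees_lt_of_eval_index_eq Finset.univ (noiseNode_injective p).injOn
    (degree_respPoly_lt _ _ _ _ _ _) (degree_respPoly_lt _ _ _ _ _ _) ?_
  rintro (k | k) -
  · change eval (p.β (Fin.castAdd p.T k)) _ = eval (p.β (Fin.castAdd p.T k)) _
    rw [eval_respPoly_β _ _ _ he, eval_respPoly_β _ _ _ he', havg n hn _ he]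
    have hr := D.ratio_mul n (slot x n j)
    rw [entityAt_slot] at hr
    have hm : ((D.maskMap ω).2.mask n (slot x n j) : F) =
      ω.2.mask n (slot x n j) * D.ratio n (slot x n j) := rfl
    rw [hm, ← hr (numHolders_ne_zero he) (numHolders_ne_zero he')]
    ring
  · change eval (p.α (Fin.castLE p.Kt_le k)) _ = eval (p.α (Fin.castLE p.Kt_le k)) _
    simp only [respPoly, eval_add, eval_mul, eval_C, eval_noisePoly_α]
    have hw : (D.maskMap ω).2.noise n (slot x n j) k c = ω.2.noise n (slot x n j) k c +
        ((ω.2.mask n (slot x n j) : F) *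
            (ansPoly x ω n (entityAt x n (slot x n j)) c).eval (p.α (Fin.castLE p.Kt_le k)) -
          (ω.2.mask n (slot x n j) * D.ratio n (slot x n j) : F) *
            (ansPoly x' (D.clientMap ω.1, ω.2) n (entityAt x n (slot x n j)) c).eval
              (p.α (Fin.castLE p.Kt_le k))) := rfl
    rw [hw, entityAt_slot]
    have hm : ((D.maskMap ω).2.mask n (slot x n j) : F) =
      ω.2.mask n (slot x n j) * D.ratio n (slot x n j) := rfl
    have ha : ansPoly x' (D.maskMap ω) n (localEntity x n j) c =
      ansPoly x' (D.clientMap ω.1, ω.2) n (localEntity x n j) c := rfl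
    rw [hm, ha]
    ring

lemma response_coinMap (hx : ∀ n ∈ 𝒯, x n = x' n)
    (havg : ∀ n ∈ 𝒯, ∀ e ∈ entities x n, average x e = average x' e) (ω : Coins p S l)
    {n : Fin p.N} (hn : n ∈ 𝒯) (v : Fin p.N) {j : Fin (numLocal x n)}
    {j' : Fin (numLocal x' n)} (hj : (j : ℕ) = j') (c : Fin p.s) :
    response x ω v n j c = response x' (D.coinMap ω) v n j' c := by
  have hs : slot x' n j' = slot x n j := Fin.ext hj.symm
  have hκ : ((D.coinMap ω).1 n).keyCoin = (ω.1 n).keyCoin := D.keyCoin_clientMap _ _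
  have hr : respPoly x' (D.coinMap ω) n (slot x n j) (localEntity x n j) c =
      respPoly x ω n (slot x n j) (localEntity x n j) c := D.respPoly_maskMap hx havg ω hn j c
  rw [response_eq, response_eq, hs, ← localEntity_congr (hx n hn) hj, hr]
  have hp : publicKey (D.coinMap ω) n = publicKey ω n := by simp only [publicKey, hκ]
  rw [hp]
  congr 1
  change responsePerm x ω v n (slot x n j) (localEntity x n j) c
      (ω.2.encCoin v n (slot x n j) c) =
    responsePerm x' (D.maskMap ω) v n (slot x n j) (localEntity x n j) c
      ((responsePerm x' (D.maskMap ω) v n (slot x n j) (entityAt x n (slot x n j)) c).symm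
        (responsePerm x ω v n (slot x n j) (entityAt x n (slot x n j)) c
          (ω.2.encCoin v n (slot x n j) c)))
  rw [entityAt_slot, Equiv.apply_symm_apply]

lemma sendPad_coinMap (ω : Coins p S l) : sendPad (D.coinMap ω) = sendPad ω := by
  funext a n v
  unfold sendPad recvPub
  have h1 : ((D.coinMap ω).1 n).sendSecret = (ω.1 n).sendSecret := D.sendSecret_clientMap _ _
  have h2 : ((D.coinMap ω).1 v).recvSecret = (ω.1 v).recvSecret := D.recvSecret_clientMap _ _
  rw [h1, h2]

lemma laterView_coinMap (h : SameForCoalition 𝒯 x x') (ω : Coins p S l) {n : Fin p.N}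
    (hn : n ∈ 𝒯) : laterView x ω n = laterView x' (D.coinMap ω) n := by
  obtain ⟨⟨hU, hL⟩, hx, havg⟩ := h
  have hM : numEntities x = numEntities x' := congrArg Finset.card hU
  have h1 : ∀ n, ((D.coinMap ω).1 n).sendSecret = (ω.1 n).sendSecret :=
    fun n => D.sendSecret_clientMap _ _
  have h2 : ∀ n, ((D.coinMap ω).1 n).recvSecret = (ω.1 n).recvSecret :=
    fun n => D.recvSecret_clientMap _ _
  have h3 : ∀ n, ((D.coinMap ω).1 n).keyCoin = (ω.1 n).keyCoin :=
    fun n => D.keyCoin_clientMap _ _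
  simp only [laterView, clientView, ClientView.mk.injEq]
  refine ⟨hx n hn, (if_pos hn).symm, hU, ?_, ?_, ?_, trivial, ?_, ?_, ?_⟩
  · simp only [sendPub, h1]
  · simp only [recvPub, h2]
  · funext v
    simp only [publicKey, h3]
  · funext v
    refine ofFn_congr_val (by rw [hM]) fun i j hij => ?_
    simp only [shareWire, padEnc, D.sendPad_coinMap, D.eval_sharePoly_coinMap hx ω v _ _ hn, hij]
    rw [unionEntity_congr hU (m' := (finProdFinEquiv.symm j).1) (by simp [hij])]
    congr 3
    exact Fin.ext (by simp [hij])
  · funext v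
    refine ofFn_congr_val (by rw [hM, hL]) fun i j hij => ?_
    simp only [queryWire, padEnc, D.sendPad_coinMap, hij]
    rw [unionEntity_congr hU (m' := (finProdFinEquiv.symm j).2) (by simp [hij, hM]),
      D.eval_queryPoly_coinMap hx ω v _ (j := (finProdFinEquiv.symm i).1)
        (j' := (finProdFinEquiv.symm j).1) (by simp [hij, hM]) hn]
  · funext v
    refine ofFn_congr_val (hL n) fun j j' hj => ?_
    funext c
    exact D.response_coinMap hx havg ω hn v hj c

end CoinTransport

theorem perfectlyPrivateAfterUnion (p : Params F) (S : Primitives F U p.N) :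
    PerfectlyPrivateAfterUnion p S := by
  intro 𝒯 h𝒯 x x' h l
  obtain ⟨D⟩ := exists_coinTransport h𝒯 h.1.2
  exact map_uniform_eq_of_bijective D.coinMap (Finite.injective_iff_bijective.1
    D.coinMap_injective) fun ω => funext fun n => D.laterView_coinMap h ω n.2

/-! ### The messages of the union protocol -/

/-- The coins with the coins of the union protocol replaced by `u`. -/
def setUnionCoins (u : Fin p.N → S.psu.Coin l) (ω : Coins p S l) : Coins p S l :=
  (fun n => { ω.1 n with union := u n }, ω.2)

/-- Completes a later view by the coins `q.1` of the union protocol and the messages in it, which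
are read off from the received vectors `q.2` and masked by pads that the client can compute. -/
noncomputable def addUnionView (w : ClientView p S l)
    (q : S.psu.Coin l × List (Fin p.N → Fin (S.psu.len l) → F)) : ClientView p S l :=
  { w with
    coins := { w.coins with union := q.1 }
    unionMsgs := fun v => List.ofFn (padEnc (k := S.psu.rounds l * S.psu.len l)
      (S.prg.gen l (S.kex.key l (w.coins.recvSecret .union v) (w.pubFromSender .union v)))
      fun i => q.2.getD (finProdFinEquiv.symm i).1 0 v (finProdFinEquiv.symm i).2) }

lemma length_received (P : UnionProtocol F U p.N) (E : Fin p.N → Finset U)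
    (u : Fin p.N → P.Coin l) (k : ℕ) (n : Fin p.N) : (P.received l E u k n).length = k := by
  induction k with
  | zero => rfl
  | succ k ih => simp [UnionProtocol.received, ih]

lemma received_getD (P : UnionProtocol F U p.N) (E : Fin p.N → Finset U)
    (u : Fin p.N → P.Coin l) {k r : ℕ} (hk : k < r) (n v : Fin p.N) :
    (P.received l E u r n).getD k 0 v = P.sent l E u k v n := by
  induction r with
  | zero => omega
  | succ r ih =>
    rw [UnionProtocol.received]
    rcases Nat.lt_succ_iff_lt_or_eq.1 hk with h | rfl
    · rw [List.getD_append _ _ _ _ (by rwa [length_received]), ih h]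
    · rw [List.getD_append_right _ _ _ _ (by rw [length_received])]
      simp [length_received, UnionProtocol.sent]

lemma clientView_setUnionCoins (x : Inputs U p) (ω : Coins p S l) (u : Fin p.N → S.psu.Coin l)
    (n : Fin p.N) :
    clientView x (setUnionCoins u ω) n = addUnionView (laterView x ω n)
      (u n, S.psu.received l (entities x) u (S.psu.rounds l) n) := by
  simp only [addUnionView, laterView, clientView, ClientView.mk.injEq]
  refine ⟨trivial, rfl, trivial, rfl, rfl, rfl, ?_, rfl, rfl, rfl⟩
  funext v
  congr 1
  unfold unionWire
  rw [← recvPad_eq_sendPad]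
  change padEnc (recvPad ω .union v n) _ = padEnc (recvPad ω .union v n) _
  congr 1
  funext i
  rw [received_getD _ _ _ (finProdFinEquiv.symm i).1.2]
  rfl

/-- Given the later views, which can be matched by a permutation of the coins, the whole views
are a function of the views in the union protocol. -/
theorem privateAgainstCoalitions (p : Params F) (S : Primitives F U p.N)
    (hpsu : S.psu.IsPrivate p.T) : PrivateAgainstCoalitions p S := by
  intro 𝒯 h𝒯 x x' h
  have hent : ∀ n ∈ 𝒯, entities x n = entities x' n := fun n hn => by
    simp only [entities, h.2.1 n hn]
  obtain ⟨ε, hε, hclose⟩ := hpsu 𝒯 h𝒯 (entities x) (entities x') hent h.1.1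
  refine ⟨ε, hε, fun l A => ?_⟩
  obtain ⟨σ, hσ⟩ :=
    exists_perm_of_map_uniform_eq (perfectlyPrivateAfterUnion p S 𝒯 h𝒯 x x' h l)
  have hres := expect_resample (A := Coins p S l) (B := Fin p.N → S.psu.Coin l)
    (fun ω n => (ω.1 n).union) setUnionCoins (fun _ => rfl) (fun _ _ => rfl) (fun _ _ _ => rfl)
  unfold coalitionDist
  rw [toOuterMeasure_map_uniform, toOuterMeasure_map_uniform, hres,
    hres fun ω => A.indicator (fun _ => (1 : ℝ)) fun n : 𝒯 => clientView x' ω n,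
    ← Fintype.expect_equiv σ (fun ω => 𝔼 u, A.indicator (fun _ => (1 : ℝ))
      fun n : 𝒯 => clientView x' (setUnionCoins u (σ ω)) n)
      (fun ω => 𝔼 u, A.indicator (fun _ => (1 : ℝ))
        fun n : 𝒯 => clientView x' (setUnionCoins u ω) n) fun _ => rfl]
  obtain ⟨ω, hω⟩ := exists_abs_expect_sub_le
    (fun ω : Coins p S l => 𝔼 u, A.indicator (fun _ => (1 : ℝ))
      fun n : 𝒯 => clientView x (setUnionCoins u ω) n)
    (fun ω : Coins p S l => 𝔼 u, A.indicator (fun _ => (1 : ℝ))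
      fun n : 𝒯 => clientView x' (setUnionCoins u (σ ω)) n)
  refine hω.trans ?_
  have hc := hclose l
    ((fun q (n : 𝒯) => addUnionView (laterView x ω n) (q n)) ⁻¹' A)
  unfold UnionProtocol.coalitionDist at hc
  rw [toOuterMeasure_map_uniform, toOuterMeasure_map_uniform] at hc
  have hlater : ∀ n : 𝒯, laterView x' (σ ω) n = laterView x ω n := fun n =>
    (congrFun (hσ ω) n).symm
  simp only [clientView_setUnionCoins, hlater]
  exact hc

end Coalition

/-! ### Boolean circuits with several outputs -/

section Circuits

/-- The values of the gates `gs` on input `x`, computed in order. -/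
def gateVals (gs : List (Wire × Wire)) (x : List Bool) : List Bool :=
  gs.foldl (fun g w => g ++ [!(w.1.value x g && w.2.value x g)]) []

lemma gateVals_concat (gs : List (Wire × Wire)) (w : Wire × Wire) (x : List Bool) :
    gateVals (gs ++ [w]) x = gateVals gs x ++
      [!(w.1.value x (gateVals gs x) && w.2.value x (gateVals gs x))] := by
  simp [gateVals, List.foldl_append]

lemma length_gateVals (gs : List (Wire × Wire)) (x : List Bool) :
    (gateVals gs x).length = gs.length := by
  induction gs using List.reverseRecOn with
  | nil => rfl
  | append_singleton gs w ih => rw [gateVals_concat]; simp [ih]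

/-- The wire of a circuit that is placed behind `m` gates and has its input bits supplied by the
wires `w`. -/
def Wire.relocate (w : ℕ → Wire) (m : ℕ) : Wire → Wire
  | .const b => .const b
  | .input i => w i
  | .gate j => .gate (j + m)

lemma Wire.value_relocate {w : ℕ → Wire} {x y V : List Bool}
    (hw : ∀ i g, (w i).value x (V ++ g) = y.getD i false) (u : Wire) (g : List Bool) :
    (u.relocate w V.length).value x (V ++ g) = u.value y g := by
  cases u with
  | const b => rfl
  | input i => exact hw i g
  | gate j =>
    simp only [Wire.relocate, Wire.value]
    rw [List.getD_append_right _ _ _ _ (by omega), Nat.add_sub_cancel]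

lemma gateVals_append_relocate {w : ℕ → Wire} {x y : List Bool} {gs : List (Wire × Wire)}
    (hw : ∀ i g, (w i).value x (gateVals gs x ++ g) = y.getD i false)
    (hs : List (Wire × Wire)) :
    gateVals (gs ++ hs.map fun u => (u.1.relocate w gs.length, u.2.relocate w gs.length)) x =
      gateVals gs x ++ gateVals hs y := by
  induction hs using List.reverseRecOn with
  | nil => simp [gateVals]
  | append_singleton hs u ih =>
    rw [List.map_append, ← List.append_assoc, List.map_singleton, gateVals_concat, ih,
      gateVals_concat, ← length_gateVals gs x, Wire.value_relocate hw, Wire.value_relocate hw,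
      List.append_assoc]

/-- The strings `out t`, which all have the same length, are computed from the strings `inp t` by
at most `q` gates. The output wires keep their values when further gates are appended. -/
def Computes {X : Type} (inp out : X → List Bool) (q : ℕ) : Prop :=
  (∃ n, ∀ t, (out t).length = n) ∧
    ∃ gs : List (Wire × Wire), gs.length ≤ q ∧ ∃ w : ℕ → Wire, ∀ t i g,
      (w i).value (inp t) (gateVals gs (inp t) ++ g) = (out t).getD i false

variable {X : Type} {inp : X → List Bool}

lemma Computes.mono {out : X → List Bool} {q q' : ℕ} (h : Computes inp out q) (hq : q ≤ q') :
    Computes inp out q' := by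
  obtain ⟨hn, gs, hgs, w⟩ := h
  exact ⟨hn, gs, hgs.trans hq, w⟩

lemma Computes.comp_right {Z : Type} {out : X → List Bool} {q : ℕ} (h : Computes inp out q)
    (f : Z → X) : Computes (fun z => inp (f z)) (fun z => out (f z)) q := by
  obtain ⟨⟨n, hn⟩, gs, hgs, w, hw⟩ := h
  exact ⟨⟨n, fun z => hn (f z)⟩, gs, hgs, w, fun z => hw (f z)⟩

lemma Computes.const (c : List Bool) : Computes inp (fun _ => c) 0 :=
  ⟨⟨c.length, fun _ => rfl⟩, [], le_rfl, fun i => .const (c.getD i false), fun _ _ _ => rfl⟩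

/-- Copying a part of the input takes no gates. -/
lemma Computes.slice {a b c : X → List Bool} {m n : ℕ} (ha : ∀ t, (a t).length = m)
    (hb : ∀ t, (b t).length = n) (h : ∀ t, inp t = a t ++ b t ++ c t) : Computes inp b 0 := by
  refine ⟨⟨n, hb⟩, [], le_rfl, fun i => if i < n then .input (m + i) else .const false,
    fun t i g => ?_⟩
  beta_reduce
  split_ifs with hi
  · change (inp t).getD (m + i) false = _
    rw [h, List.append_assoc, List.getD_append_right _ _ _ _ (by rw [ha]; omega), ha,
      Nat.add_sub_cancel_left, List.getD_append _ _ _ _ (by rwa [hb])]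
  · rw [List.getD_eq_default _ _ (by rw [hb]; omega)]
    rfl

lemma Computes.comp {mid out : X → List Bool} {q q' : ℕ} (h : Computes inp mid q)
    (h' : Computes mid out q') : Computes inp out (q + q') := by
  obtain ⟨-, gs, hgs, w, hw⟩ := h
  obtain ⟨hn, gs', hgs', w', hw'⟩ := h'
  refine ⟨hn, gs ++ gs'.map fun u => (u.1.relocate w gs.length, u.2.relocate w gs.length),
    by simpa using Nat.add_le_add hgs hgs', fun i => (w' i).relocate w gs.length,
    fun t i g => ?_⟩
  rw [gateVals_append_relocate (hw t), List.append_assoc, ← length_gateVals gs (inp t),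
    Wire.value_relocate (hw t), hw']

lemma Computes.append {out out' : X → List Bool} {q q' : ℕ} (h : Computes inp out q)
    (h' : Computes inp out' q') : Computes inp (fun t => out t ++ out' t) (q + q') := by
  obtain ⟨⟨n, hn⟩, gs, hgs, w, hw⟩ := h
  obtain ⟨⟨n', hn'⟩, gs', hgs', w', hw'⟩ := h'
  have hin : ∀ t i g, (Wire.input i).value (inp t) (gateVals gs (inp t) ++ g) =
    (inp t).getD i false := fun _ _ _ => rfl
  refine ⟨⟨n + n', fun t => by simp [hn, hn']⟩,
    gs ++ gs'.map fun u => (u.1.relocate .input gs.length, u.2.relocate .input gs.length),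
    by simpa using Nat.add_le_add hgs hgs',
    fun i => if i < n then w i else (w' (i - n)).relocate .input gs.length, fun t i g => ?_⟩
  rw [gateVals_append_relocate (hin t), List.append_assoc]
  beta_reduce
  split_ifs with hi
  · rw [hw, List.getD_append _ _ _ _ (by rwa [hn])]
  · rw [← length_gateVals gs (inp t), Wire.value_relocate (hin t), hw',
      List.getD_append_right _ _ _ _ (by rw [hn]; omega), hn]

lemma Computes.ofCircuit (C : Circuit) {f : X → Bool} (h : ∀ t, C.eval (inp t) = f t) :
    Computes inp (fun t => [f t]) C.size := by
  refine ⟨⟨1, fun _ => rfl⟩, C.gates, le_rfl, ?_⟩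
  -- A reference to a missing gate has the value `false`, and would change its value when gates
  -- are appended.
  have hstable : ∃ u : Wire, ∀ t g,
      u.value (inp t) (gateVals C.gates (inp t) ++ g) = f t := by
    simp only [← h]
    unfold Circuit.eval
    change ∃ u : Wire, ∀ t g, u.value (inp t) (gateVals C.gates (inp t) ++ g) =
      C.out.value (inp t) (gateVals C.gates (inp t))
    cases C.out with
    | const b => exact ⟨.const b, fun _ _ => rfl⟩
    | input i => exact ⟨.input i, fun _ _ => rfl⟩
    | gate j =>
      by_cases hj : j < C.gates.length
      · refine ⟨.gate j, fun t g => ?_⟩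
        simp only [Wire.value]
        rw [List.getD_append _ _ _ _ (by rwa [length_gateVals])]
      · refine ⟨.const false, fun t g => ?_⟩
        simp only [Wire.value]
        rw [List.getD_eq_default _ _ (by rw [length_gateVals]; omega)]
  obtain ⟨u, hu⟩ := hstable
  refine ⟨fun i => if i = 0 then u else .const false, fun t i g => ?_⟩
  rcases i with _ | i
  · simpa using hu t g
  · simp [Wire.value]

/-- A distinguisher of the outputs yields a distinguisher of the inputs. -/
lemma Computes.exists_circuit {out : X → List Bool} {q : ℕ} (h : Computes inp out q)
    (C : Circuit) : ∃ C' : Circuit, C'.size ≤ C.size + q ∧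
      ∀ t, C'.eval (inp t) = C.eval (out t) := by
  obtain ⟨-, gs, hgs, w, hw⟩ := h
  refine ⟨⟨gs ++ C.gates.map fun u => (u.1.relocate w gs.length, u.2.relocate w gs.length),
    C.out.relocate w gs.length⟩, ?_, fun t => ?_⟩
  · simp only [Circuit.size, List.length_append, List.length_map]
    omega
  · change (C.out.relocate w gs.length).value (inp t) (gateVals _ (inp t)) =
      C.out.value (out t) (gateVals C.gates (out t))
    rw [gateVals_append_relocate (hw t), ← length_gateVals gs (inp t),
      Wire.value_relocate (hw t)]

lemma Computes.concat {n q : ℕ} {out : X → Fin n → List Bool}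
    (h : ∀ i, Computes inp (fun t => out t i) q) :
    Computes inp (fun t => SecEA.concat (out t)) (n * q) := by
  induction n with
  | zero => exact (Computes.const []).mono (by simp)
  | succ n ih =>
    have := (h 0).append (ih (out := fun t i => out t i.succ) fun i => h i.succ)
    refine (Computes.mono ?_ (q := q + n * q) (by rw [Nat.succ_mul]; omega))
    simpa [SecEA.concat, List.ofFn_succ] using this

lemma eq_concat_bits {n : ℕ} {c : List Bool} (h : c.length = n) :
    c = concat fun i : Fin n => [c.getD i false] := by
  subst h
  have : ∀ l : List Bool, (l.map fun b => [b]).flatten = l := fun l => by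
    induction l with
    | nil => rfl
    | cons b l ih => simp [ih]
  conv_lhs => rw [← this c]
  unfold concat
  congr 1
  apply List.ext_getElem
  · simp
  · intro i h1 h2
    simp

/-- A string is computable if its bits are. -/
lemma Computes.of_bits {out : X → List Bool} {n q : ℕ} (hn : ∀ t, (out t).length = n)
    (h : ∀ i < n, Computes inp (fun t => [(out t).getD i false]) q) :
    Computes inp out (n * q) := by
  have := Computes.concat (inp := inp) (out := fun t (i : Fin n) => [(out t).getD i false])
    fun i => h i i.2
  simpa only [← eq_concat_bits (hn _)] using this

lemma Computes.nand {f g : X → Bool} {q q' : ℕ} (hf : Computes inp (fun t => [f t]) q)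
    (hg : Computes inp (fun t => [g t]) q') :
    Computes inp (fun t => [!(f t && g t)]) (q + q' + 1) :=
  (hf.append hg).comp (Computes.ofCircuit ⟨[(.input 0, .input 1)], .gate 0⟩ fun _ => rfl)

lemma Computes.not {f : X → Bool} {q : ℕ} (hf : Computes inp (fun t => [f t]) q) :
    Computes inp (fun t => [!f t]) (q + q + 1) := by
  simpa using hf.nand hf

lemma Computes.and {f g : X → Bool} {q q' : ℕ} (hf : Computes inp (fun t => [f t]) q)
    (hg : Computes inp (fun t => [g t]) q') :
    ∃ q'', Computes inp (fun t => [f t && g t]) q'' :=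
  ⟨_, by simpa only [Bool.not_not] using (hf.nand hg).not⟩

lemma Computes.or {f g : X → Bool} {q q' : ℕ} (hf : Computes inp (fun t => [f t]) q)
    (hg : Computes inp (fun t => [g t]) q') :
    ∃ q'', Computes inp (fun t => [f t || g t]) q'' :=
  ⟨_, by simpa only [Bool.not_and, Bool.not_not] using hf.not.nand hg.not⟩

section Tables

variable {F : Type} (codeF : BitCode F)

open Classical in
lemma exists_computes_eq (y : F) :
    ∃ q, Computes codeF.code (fun t => [decide (t = y)]) q := by
  have key : ∀ m, ∃ q, Computes codeF.code
      (fun t => [decide (∀ i < m, (codeF.code t).getD i false = (codeF.code y).getD i false)])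
      q := by
    intro m
    induction m with
    | zero => exact ⟨0, by simpa using Computes.const [true]⟩
    | succ m ih =>
      obtain ⟨q, hq⟩ := ih
      have h1 : Computes codeF.code (fun t => [(codeF.code t).getD m false]) 0 :=
        Computes.ofCircuit ⟨[], .input m⟩ fun _ => rfl
      have h2 : ∃ q, Computes codeF.code
          (fun t => [decide ((codeF.code t).getD m false = (codeF.code y).getD m false)]) q := by
        cases (codeF.code y).getD m false with
        | true => exact ⟨_, by simpa using h1⟩
        | false => exact ⟨_, by simpa using h1.not⟩
      obtain ⟨q', hq'⟩ := h2
      obtain ⟨q'', h⟩ := hq.and hq'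
      refine ⟨q'', ?_⟩
      convert h using 3
      rw [← Bool.decide_and, decide_eq_decide]
      constructor
      · exact fun h => ⟨fun i hi => h i (by omega), h m (by omega)⟩
      · intro h i hi
        rcases Nat.lt_succ_iff_lt_or_eq.1 hi with h' | rfl
        exacts [h.1 i h', h.2]
  obtain ⟨q, hq⟩ := key codeF.len
  refine ⟨q, ?_⟩
  convert hq using 3 with t
  rw [decide_eq_decide]
  constructor
  · rintro rfl i _
    rfl
  · intro h
    apply codeF.code_injective
    rw [eq_concat_bits (codeF.length_code t), eq_concat_bits (codeF.length_code y)]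
    congr 1
    funext i
    rw [h i i.2]

variable [Fintype F]

open Classical in
/-- Every function on a finite set is computed by some circuit. -/
lemma exists_computes_table (f : F → Bool) :
    ∃ q, Computes codeF.code (fun t => [f t]) q := by
  have key : ∀ s : Finset F, ∃ q, Computes codeF.code (fun t => [decide (t ∈ s)]) q := by
    intro s
    induction s using Finset.induction_on with
    | empty => exact ⟨0, by simpa using Computes.const [false]⟩
    | insert y s _ ih =>
      obtain ⟨q, hq⟩ := ih
      obtain ⟨q', hq'⟩ := exists_computes_eq codeF y
      obtain ⟨q'', h⟩ := hq'.or hq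
      exact ⟨q'', by simpa [Finset.mem_insert] using h⟩
  obtain ⟨q, hq⟩ := key (Finset.univ.filter fun t => f t = true)
  exact ⟨q, by simpa using hq⟩

/-- The operations of a finite field are computed by circuits of bounded size. -/
lemma exists_computes_map : ∃ q, ∀ φ : F → F,
    Computes codeF.code (fun t => codeF.code (φ t)) q := by
  classical
  have h : ∀ φ : F → F, ∃ q, Computes codeF.code (fun t => codeF.code (φ t)) q := by
    intro φ
    choose q hq using fun i => exists_computes_table codeF fun t => (codeF.code (φ t)).getD i false
    refine ⟨_, Computes.of_bits (q := (Finset.range codeF.len).sup q)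
      (fun t => codeF.length_code _) fun i hi => (hq i).mono ?_⟩
    exact Finset.le_sup (f := q) (Finset.mem_range.2 hi)
  choose q hq using h
  exact ⟨Finset.univ.sup q, fun φ => (hq φ).mono (Finset.le_sup (Finset.mem_univ φ))⟩

end Tables

end Circuits

/-! ### Computational indistinguishability and hybrids -/

section Indistinguishability

lemma polyBounded_iff {f : ℕ → ℕ} : PolyBounded f ↔ ∃ k, ∀ l, f l ≤ (l + 2) ^ k := by
  constructor
  · rintro ⟨k, hk⟩
    refine ⟨k + 1, fun l => (hk l).trans ?_⟩
    have h1 : l ^ k ≤ (l + 2) ^ k := Nat.pow_le_pow_left (by omega) k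
    have h2 : k ≤ (l + 2) ^ k :=
      (Nat.lt_two_pow_self).le.trans (Nat.pow_le_pow_left (by omega) k)
    rw [pow_succ]
    nlinarith
  · rintro ⟨k, hk⟩
    refine ⟨2 * k + 3 ^ k, fun l => (hk l).trans ?_⟩
    rcases Nat.lt_or_ge l 2 with hl | hl
    · have : (l + 2) ^ k ≤ 3 ^ k := Nat.pow_le_pow_left (by omega) k
      omega
    · have h1 : (l + 2) ^ k ≤ (l ^ 2) ^ k := Nat.pow_le_pow_left (by nlinarith) k
      have h2 : (l ^ 2) ^ k ≤ l ^ (2 * k + 3 ^ k) := by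
        rw [← pow_mul]
        exact Nat.pow_le_pow_right (by omega) (Nat.le_add_right _ _)
      exact (h1.trans h2).trans (Nat.le_add_right _ _)

lemma PolyBounded.mono {f g : ℕ → ℕ} (hg : PolyBounded g) (h : ∀ l, f l ≤ g l) :
    PolyBounded f := by
  obtain ⟨k, hk⟩ := hg
  exact ⟨k, fun l => (h l).trans (hk l)⟩

lemma PolyBounded.const (c : ℕ) : PolyBounded fun _ => c :=
  ⟨c, fun _ => Nat.le_add_left _ _⟩

lemma PolyBounded.mul {f g : ℕ → ℕ} (hf : PolyBounded f) (hg : PolyBounded g) :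
    PolyBounded fun l => f l * g l := by
  rw [polyBounded_iff] at *
  obtain ⟨k, hk⟩ := hf
  obtain ⟨m, hm⟩ := hg
  exact ⟨k + m, fun l => (Nat.mul_le_mul (hk l) (hm l)).trans (pow_add _ _ _).ge⟩

lemma PolyBounded.add {f g : ℕ → ℕ} (hf : PolyBounded f) (hg : PolyBounded g) :
    PolyBounded fun l => f l + g l := by
  rw [polyBounded_iff] at *
  obtain ⟨k, hk⟩ := hf
  obtain ⟨m, hm⟩ := hg
  refine ⟨k + m + 1, fun l => ?_⟩
  have h1 : (l + 2) ^ k ≤ (l + 2) ^ (k + m) := Nat.pow_le_pow_right (by omega) (by omega)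
  have h2 : (l + 2) ^ m ≤ (l + 2) ^ (k + m) := Nat.pow_le_pow_right (by omega) (by omega)
  have h3 : (l + 2) ^ (k + m + 1) = (l + 2) ^ (k + m) * (l + 2) := pow_succ _ _
  have := hk l
  have := hm l
  nlinarith

lemma Negligible.of_abs_le {f g : ℕ → ℝ} (hg : Negligible g) (h : ∀ l, |f l| ≤ |g l|) :
    Negligible f :=
  Asymptotics.SuperpolynomialDecay.trans_abs_le hg h

lemma CompIndist.refl (P : ℕ → PMF (List Bool)) : CompIndist P P := by
  intro C _
  simp only [sub_self, abs_zero]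
  exact Asymptotics.superpolynomialDecay_zero Filter.atTop fun l : ℕ => (l : ℝ)

lemma CompIndist.symm {P Q : ℕ → PMF (List Bool)} (h : CompIndist P Q) : CompIndist Q P := by
  intro C hC
  simpa only [abs_sub_comm] using h C hC

lemma CompIndist.trans {P Q R : ℕ → PMF (List Bool)} (h : CompIndist P Q)
    (h' : CompIndist Q R) : CompIndist P R := by
  intro C hC
  refine Negligible.of_abs_le (Asymptotics.SuperpolynomialDecay.add (h C hC) (h' C hC))
    fun l => ?_
  rw [abs_abs]
  exact (abs_sub_le _ _ _).trans (le_abs_self _)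

/-- The probability that a circuit accepts, as an average over the coins. -/
lemma map_circuit_toReal {Ω : Type} [Fintype Ω] [Nonempty Ω] (f : Ω → List Bool) (C : Circuit) :
    ((((PMF.uniformOfFintype Ω).map f).map C.eval) true).toReal =
      𝔼 ω, if C.eval (f ω) = true then (1 : ℝ) else 0 := by
  rw [PMF.map_comp, map_uniform_apply_toReal]
  rfl

lemma map_uniform_fst {Ω Ω' B X : Type} [Fintype Ω] [Nonempty Ω] [Fintype Ω'] [Nonempty Ω']
    [Finite B] [Nonempty B] (e : Ω ≃ Ω' × B) {f : Ω → X} {g : Ω' → X}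
    (h : ∀ ω, f ω = g (e ω).1) :
    (PMF.uniformOfFintype Ω).map f = (PMF.uniformOfFintype Ω').map g := by
  classical
  have := Fintype.ofFinite B
  refine PMF.ext fun b => ?_
  rw [← ENNReal.toReal_eq_toReal_iff' (PMF.apply_ne_top _ _) (PMF.apply_ne_top _ _),
    map_uniform_apply_toReal, map_uniform_apply_toReal]
  rw [Fintype.expect_equiv e _ (fun ω : Ω' × B => if g ω.1 = b then (1 : ℝ) else 0)
    fun ω => by rw [h], ← Finset.univ_product_univ,
    Finset.expect_product' univ univ (fun a (_ : B) => if g a = b then (1 : ℝ) else 0)]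
  simp

section Hybrid

variable {I : Type} [Fintype I] [DecidableEq I] {R : ℕ → Type} {A B Y : ℕ → I → Type}

/-- The game in which the components in `J` are drawn as in the second of two families, and the
others as in the first. -/
def mixedGame (f : ∀ l, R l → ∀ i, A l i → Y l i) (g : ∀ l, R l → ∀ i, B l i → Y l i)
    (V : ∀ l, R l → (∀ i, Y l i) → List Bool) (J : Finset I) (l : ℕ)
    (ω : R l × (∀ i, A l i) × (∀ i, B l i)) : List Bool :=
  V l ω.1 fun i => if i ∈ J then g l ω.1 i (ω.2.2 i) else f l ω.1 i (ω.2.1 i)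

variable [∀ l, Fintype (R l)] [∀ l, Nonempty (R l)]
  [∀ l i, Fintype (A l i)] [∀ l i, Nonempty (A l i)] [∀ l i, Fintype (B l i)]
  [∀ l i, Nonempty (B l i)]

/-- One step of the hybrid argument: all coins but those of component `i` are fixed in the best
way, separately for each security parameter. -/
lemma compIndist_mixedGame_insert (f : ∀ l, R l → ∀ i, A l i → Y l i)
    (g : ∀ l, R l → ∀ i, B l i → Y l i) (code : ∀ l i, Y l i → List Bool)
    (V : ∀ l, R l → (∀ i, Y l i) → List Bool)
    (hsec : ∀ i (r : ∀ l, R l), CompIndist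
      (fun l => (PMF.uniformOfFintype (A l i)).map fun a => code l i (f l (r l) i a))
      (fun l => (PMF.uniformOfFintype (B l i)).map fun b => code l i (g l (r l) i b)))
    {q : ℕ → ℕ} (hq : PolyBounded q)
    (hV : ∀ l r i y, Computes (code l i) (fun t => V l r (Function.update y i t)) (q l))
    {J : Finset I} {i : I} (hi : i ∉ J) :
    CompIndist (fun l => (PMF.uniformOfFintype _).map (mixedGame f g V J l))
      (fun l => (PMF.uniformOfFintype _).map (mixedGame f g V (insert i J) l)) := by
  intro C hC
  set y : ∀ l, (R l × (∀ i, A l i) × (∀ i, B l i)) → ∀ i, Y l i := fun l ω i =>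
    if i ∈ J then g l ω.1 i (ω.2.2 i) else f l ω.1 i (ω.2.1 i) with hy
  set φ : ∀ l, (R l × (∀ i, A l i) × (∀ i, B l i)) → Y l i → ℝ := fun l ω t =>
    if (C l).eval (V l ω.1 (Function.update (y l ω) i t)) = true then 1 else 0 with hφ
  have h1 : ∀ l, ((((PMF.uniformOfFintype _).map (mixedGame f g V J l)).map (C l).eval)
      true).toReal = 𝔼 ω, 𝔼 a, φ l ω (f l ω.1 i a) := by
    intro l
    rw [map_circuit_toReal, expect_resample
      (fun ω : R l × (∀ i, A l i) × (∀ i, B l i) => ω.2.1 i)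
      (fun a ω => (ω.1, Function.update ω.2.1 i a, ω.2.2)) (by simp) (by simp) (by simp)]
    refine Finset.expect_congr rfl fun ω _ => Finset.expect_congr rfl fun a _ => ?_
    have : (fun j => if j ∈ J then g l ω.1 j (ω.2.2 j) else
        f l ω.1 j (Function.update ω.2.1 i a j)) =
        Function.update (y l ω) i (f l ω.1 i a) := by
      funext j
      rcases eq_or_ne j i with rfl | hj
      · simp [hi]
      · simp [hj, hy]
    simp only [mixedGame, this, hφ]
  have h2 : ∀ l, ((((PMF.uniformOfFintype _).map (mixedGame f g V (insert i J) l)).map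
      (C l).eval) true).toReal = 𝔼 ω, 𝔼 b, φ l ω (g l ω.1 i b) := by
    intro l
    rw [map_circuit_toReal, expect_resample
      (fun ω : R l × (∀ i, A l i) × (∀ i, B l i) => ω.2.2 i)
      (fun b ω => (ω.1, ω.2.1, Function.update ω.2.2 i b)) (by simp) (by simp) (by simp)]
    refine Finset.expect_congr rfl fun ω _ => Finset.expect_congr rfl fun b _ => ?_
    have : (fun j => if j ∈ insert i J then g l ω.1 j (Function.update ω.2.2 i b j) else
        f l ω.1 j (ω.2.1 j)) = Function.update (y l ω) i (g l ω.1 i b) := by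
      funext j
      rcases eq_or_ne j i with rfl | hj
      · simp
      · simp [hj, hy]
    simp only [mixedGame, this, hφ]
  choose ω hω using fun l => exists_abs_expect_sub_le
    (fun ω : R l × (∀ i, A l i) × (∀ i, B l i) => 𝔼 a, φ l ω (f l ω.1 i a))
    (fun ω => 𝔼 b, φ l ω (g l ω.1 i b))
  choose C' hC' hC'_eval using fun l => (hV l (ω l).1 i (y l (ω l))).exists_circuit (C l)
  refine Negligible.of_abs_le
    (hsec i (fun l => (ω l).1) C' ((hC.add hq).mono hC')) fun l => ?_
  rw [abs_abs, abs_abs, h1, h2, map_circuit_toReal, map_circuit_toReal]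
  refine (hω l).trans (le_of_eq ?_)
  simp only [hφ, hC'_eval]

/-- The hybrid argument: if the view is computable from each single component, then components
with indistinguishable distributions may be exchanged in all positions at once. -/
lemma compIndist_hybrid (f : ∀ l, R l → ∀ i, A l i → Y l i)
    (g : ∀ l, R l → ∀ i, B l i → Y l i) (code : ∀ l i, Y l i → List Bool)
    (V : ∀ l, R l → (∀ i, Y l i) → List Bool)
    (hsec : ∀ i (r : ∀ l, R l), CompIndist
      (fun l => (PMF.uniformOfFintype (A l i)).map fun a => code l i (f l (r l) i a))
      (fun l => (PMF.uniformOfFintype (B l i)).map fun b => code l i (g l (r l) i b)))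
    {q : ℕ → ℕ} (hq : PolyBounded q)
    (hV : ∀ l r i y, Computes (code l i) (fun t => V l r (Function.update y i t)) (q l)) :
    CompIndist
      (fun l => (PMF.uniformOfFintype (R l × ∀ i, A l i)).map fun ω =>
        V l ω.1 fun i => f l ω.1 i (ω.2 i))
      (fun l => (PMF.uniformOfFintype (R l × ∀ i, B l i)).map fun ω =>
        V l ω.1 fun i => g l ω.1 i (ω.2 i)) := by
  have key : ∀ J : Finset I, CompIndist
      (fun l => (PMF.uniformOfFintype _).map (mixedGame f g V ∅ l))
      (fun l => (PMF.uniformOfFintype _).map (mixedGame f g V J l)) := by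
    intro J
    induction J using Finset.induction_on with
    | empty => exact CompIndist.refl _
    | insert i J hi ih =>
      exact ih.trans (compIndist_mixedGame_insert f g code V hsec hq hV hi)
  have h0 : (fun l => (PMF.uniformOfFintype _).map (mixedGame f g V ∅ l)) =
      fun l => (PMF.uniformOfFintype (R l × ∀ i, A l i)).map fun ω =>
        V l ω.1 fun i => f l ω.1 i (ω.2 i) := by
    funext l
    refine map_uniform_fst (Equiv.prodAssoc (R l) (∀ i, A l i) (∀ i, B l i)).symm fun ω => ?_
    simp [mixedGame]
  have h1 : (fun l => (PMF.uniformOfFintype _).map (mixedGame f g V univ l)) =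
      fun l => (PMF.uniformOfFintype (R l × ∀ i, B l i)).map fun ω =>
        V l ω.1 fun i => g l ω.1 i (ω.2 i) := by
    funext l
    refine map_uniform_fst (((Equiv.refl (R l)).prodCongr (Equiv.prodComm _ _)).trans
      (Equiv.prodAssoc (R l) (∀ i, B l i) (∀ i, A l i)).symm) fun ω => ?_
    simp [mixedGame]
  have := key univ
  rwa [h0, h1] at this

end Hybrid

end Indistinguishability

/-! ### The view of the server as a function of the primitives -/

section Server

lemma map_uniform_resample {A B X : Type} [Fintype A] [Nonempty A] [Fintype B] [Nonempty B]
    (get : A → B) (set : B → A → A) (set_get : ∀ a, set (get a) a = a)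
    (get_set : ∀ b a, get (set b a) = b) (set_set : ∀ b b' a, set b (set b' a) = set b a)
    (φ : A → X) :
    (PMF.uniformOfFintype A).map φ =
      (PMF.uniformOfFintype (A × B)).map fun q => φ (set q.2 q.1) := by
  classical
  refine PMF.ext fun b => ?_
  rw [← ENNReal.toReal_eq_toReal_iff' (PMF.apply_ne_top _ _) (PMF.apply_ne_top _ _),
    map_uniform_apply_toReal, map_uniform_apply_toReal,
    expect_resample get set set_get get_set set_set, ← Finset.univ_product_univ,
    Finset.expect_product]

/-- A block of a concatenation of blocks of equal length is a part of it. -/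
lemma Computes.block {X : Type} {m n : ℕ} {f : X → Fin n → List Bool}
    (hm : ∀ t i, (f t i).length = m) (i : Fin n) :
    Computes (fun t => SecEA.concat (f t)) (fun t => f t i) 0 := by
  induction n with
  | zero => exact i.elim0
  | succ n ih =>
    have hsplit : ∀ t, SecEA.concat (f t) = f t 0 ++ SecEA.concat fun j => f t j.succ := fun t => by
      simp [SecEA.concat, List.ofFn_succ]
    have hlen : ∀ t, (SecEA.concat fun j : Fin n => f t j.succ).length = n * m := fun t => by
      simp [SecEA.concat, List.length_flatten, hm, Function.comp_def]
    refine Fin.cases ?_ (fun i => ?_) i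
    · exact Computes.slice (a := fun _ => []) (c := fun t => SecEA.concat fun j => f t j.succ)
        (fun _ => rfl) (fun t => hm t 0) fun t => by rw [hsplit]; rfl
    · have h1 : Computes (fun t => SecEA.concat (f t)) (fun t => SecEA.concat fun j => f t j.succ) 0 :=
        Computes.slice (c := fun _ => []) (fun t => hm t 0) hlen fun t => by
          rw [hsplit, List.append_nil]
      exact h1.comp (ih (f := fun t j => f t j.succ) (fun t j => hm t _) i)

variable {F U : Type} [Field F] [Fintype U] [LinearOrder U] {p : Params F}

/-- The pairwise pads: one for each purpose, sender and receiver. -/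
abbrev PadIndex (p : Params F) : Type := Phase × Fin p.N × Fin p.N

variable (S : Primitives F U p.N) {l : ℕ}

variable (l) in
/-- A bound for the length of all messages of one purpose from one client to another. -/
def streamLen : ℕ :=
  S.psu.rounds l * S.psu.len l + Fintype.card U * p.s + Fintype.card U * Fintype.card U

lemma polyBounded_streamLen : PolyBounded (streamLen S) :=
  (S.psu.polyBounded.add (.const _)).add (.const _)

variable [Fintype F]

/-- The view of the server as a function of what it consists of: the union `B` of the entity sets,
the numbers `L` of local entities, the key exchange messages, the public keys, the masked messages
(of which only the initial segments of the right lengths are used), the encrypted answers in all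
slots (of which only the used ones count), and the server's coins. -/
noncomputable def relayView (codeF : BitCode F) (B : Finset U) (L : Fin p.N → ℕ)
    (hL : ∀ n, L n ≤ Fintype.card U) (pub : PadIndex p → S.kex.Pub l × S.kex.Pub l)
    (pk : Fin p.N → S.phe.PK l) (wire : PadIndex p → ℕ → F)
    (ct : Fin p.N → Fin p.N → Fin (Fintype.card U) → Fin p.s → S.phe.CT l)
    (srv : ServerCoins p S l) : List Bool :=
  ((Finset.univ : Finset U).sort (· ≤ ·)).map (fun e => decide (e ∈ B)) ++
  [Phase.union, Phase.share, Phase.query].flatMap (fun a => concat fun n => concat fun v =>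
    (S.kex.pubCode l).code (pub (a, n, v)).1 ++ (S.kex.pubCode l).code (pub (a, n, v)).2) ++
  (concat fun n => (S.phe.pkCode l).code (pk n)) ++
  (concat fun n => concat fun v => concat fun i : Fin (S.psu.rounds l * S.psu.len l) =>
    codeF.code (wire (.union, n, v) i)) ++
  (concat fun n => concat fun v => concat fun i : Fin (B.card * p.s) =>
    codeF.code (wire (.share, n, v) i)) ++
  (concat fun n => concat fun v => concat fun i : Fin (L n * B.card) =>
    codeF.code (wire (.query, n, v) i)) ++
  (concat fun v => concat fun n => concat fun j : Fin (L n) => concat fun c =>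
    (S.phe.ctCode l).code (ct v n (Fin.castLE (hL n) j) c)) ++
  (concat fun n => concat fun i => codeF.code (srv.mask n i : F)) ++
  (concat fun n => concat fun i => concat fun k => concat fun c =>
    codeF.code (srv.noise n i k c)) ++
  (concat fun v => concat fun n => concat fun i => concat fun c =>
    (S.phe.encCoinCode l).code (srv.encCoin v n i c))

section RelayView

variable {S} (codeF : BitCode F) (B : Finset U) {L : Fin p.N → ℕ}
  (hL : ∀ n, L n ≤ Fintype.card U)

lemma lt_streamLen_of_lt (B : Finset U) (hL : ∀ n, L n ≤ Fintype.card U) :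
    (∀ k, k < S.psu.rounds l * S.psu.len l → k < streamLen S l) ∧
    (∀ k, k < B.card * p.s → k < streamLen S l) ∧
    ∀ n k, k < L n * B.card → k < streamLen S l := by
  have hB := B.card_le_univ
  have h1 : B.card * p.s ≤ Fintype.card U * p.s := Nat.mul_le_mul_right _ hB
  have h2 : ∀ n, L n * B.card ≤ Fintype.card U * Fintype.card U := fun n =>
    Nat.mul_le_mul (hL n) hB
  unfold streamLen
  refine ⟨fun k hk => by omega, fun k hk => by omega, fun n k hk => ?_⟩
  have := h2 n
  omega

lemma relayView_congr (pub : PadIndex p → S.kex.Pub l × S.kex.Pub l) (pk : Fin p.N → S.phe.PK l)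
    {wire wire' : PadIndex p → ℕ → F}
    (ct : Fin p.N → Fin p.N → Fin (Fintype.card U) → Fin p.s → S.phe.CT l)
    (srv : ServerCoins p S l) (h : ∀ i, ∀ k < streamLen S l, wire i k = wire' i k) :
    relayView S codeF B L hL pub pk wire ct srv = relayView S codeF B L hL pub pk wire' ct srv := by
  obtain ⟨h1, h2, h3⟩ := lt_streamLen_of_lt (S := S) (l := l) B hL
  have h1' : ∀ n v (i : Fin (S.psu.rounds l * S.psu.len l)),
      wire (.union, n, v) i = wire' (.union, n, v) i := fun n v i => h _ _ (h1 _ i.2)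
  have h2' : ∀ n v (i : Fin (B.card * p.s)),
      wire (.share, n, v) i = wire' (.share, n, v) i := fun n v i => h _ _ (h2 _ i.2)
  have h3' : ∀ n v (i : Fin (L n * B.card)),
      wire (.query, n, v) i = wire' (.query, n, v) i := fun n v i => h _ _ (h3 n _ i.2)
  simp only [relayView, h1', h2', h3']

/-- The number of gates for the masked messages, if `c` gates suffice for each entry. -/
def relayCost (S : Primitives F U p.N) (l c : ℕ) : ℕ := 3 * (p.N * (p.N * (streamLen S l * c)))

lemma computes_relayView {X : Type} {inp : X → List Bool}
    {pub : X → PadIndex p → S.kex.Pub l × S.kex.Pub l} {pk : X → Fin p.N → S.phe.PK l}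
    {wire : X → PadIndex p → ℕ → F}
    {ct : X → Fin p.N → Fin p.N → Fin (Fintype.card U) → Fin p.s → S.phe.CT l}
    (srv : ServerCoins p S l) {q : ℕ}
    (hpub : ∀ i, Computes inp (fun t => (S.kex.pubCode l).code (pub t i).1 ++
      (S.kex.pubCode l).code (pub t i).2) 0)
    (hpk : ∀ n, Computes inp (fun t => (S.phe.pkCode l).code (pk t n)) 0)
    (hwire : ∀ i, ∀ k < streamLen S l, Computes inp (fun t => codeF.code (wire t i k)) q)
    (hct : ∀ v n i c, Computes inp (fun t => (S.phe.ctCode l).code (ct t v n i c)) 0) :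
    Computes inp (fun t => relayView S codeF B L hL (pub t) (pk t) (wire t) (ct t) srv)
      (relayCost S l q) := by
  obtain ⟨h1, h2, h3⟩ := lt_streamLen_of_lt (S := S) (l := l) B hL
  have hpubs : ∀ a, Computes inp (fun t => concat fun n => concat fun v =>
      (S.kex.pubCode l).code (pub t (a, n, v)).1 ++ (S.kex.pubCode l).code (pub t (a, n, v)).2)
      0 := fun a =>
    (Computes.concat fun n => Computes.concat fun v => hpub (a, n, v)).mono (by simp)
  have hpubs' : Computes inp (fun t => [Phase.union, Phase.share, Phase.query].flatMap
      (fun a => concat fun n => concat fun v => (S.kex.pubCode l).code (pub t (a, n, v)).1 ++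
        (S.kex.pubCode l).code (pub t (a, n, v)).2)) 0 := by
    simp only [List.flatMap_cons, List.flatMap_nil]
    exact (hpubs _).append ((hpubs _).append ((hpubs _).append (Computes.const [])))
  have hseg : ∀ a n v m, (∀ k, k < m → k < streamLen S l) → Computes inp
      (fun t => concat fun i : Fin m => codeF.code (wire t (a, n, v) i)) (streamLen S l * q) :=
    fun a n v m hm => (Computes.concat fun i => hwire _ _ (hm i i.2)).mono <| by
      refine Nat.mul_le_mul_right _ ?_
      by_contra hcon
      exact lt_irrefl _ (hm (streamLen S l) (by omega))
  have hcts : Computes inp (fun t => concat fun v => concat fun n => concat fun j : Fin (L n) =>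
      concat fun c => (S.phe.ctCode l).code (ct t v n (Fin.castLE (hL n) j) c)) 0 := by
    refine (Computes.concat (q := 0) fun v => (Computes.concat (q := 0) fun n =>
      (Computes.concat (q := 0) fun j => (Computes.concat (q := 0) fun c => hct v n _ c).mono
        (by simp)).mono (by simp)).mono (by simp)).mono (by simp)
  unfold relayView
  refine Computes.mono ((((((((((Computes.const _).append hpubs').append
    (Computes.concat hpk)).append
    (Computes.concat fun n => Computes.concat fun v => hseg .union n v _ h1)).append
    (Computes.concat fun n => Computes.concat fun v => hseg .share n v _ h2)).append
    (Computes.concat fun n => Computes.concat fun v => hseg .query n v _ (h3 n))).append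
    hcts).append (Computes.const _)).append (Computes.const _)).append (Computes.const _)) ?_
  unfold relayCost
  omega

lemma polyBounded_relayCost {q : ℕ → ℕ} (hq : PolyBounded q) :
    PolyBounded fun l => relayCost S l (q l) :=
  (PolyBounded.const 3).mul ((PolyBounded.const _).mul ((PolyBounded.const _).mul
    ((polyBounded_streamLen S).mul hq)))

end RelayView

/-! ### Games for the view of the server -/

variable {S}
variable (codeF : BitCode F) (x : Inputs U p) (ω : Coins p S l)

/-- The messages of the three phases before masking, continued by zeros. -/
noncomputable def plainStream : PadIndex p → ℕ → F
  | (.union, n, v), k =>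
    if h : k < S.psu.rounds l * S.psu.len l then
      S.psu.sent l (entities x) (fun u => (ω.1 u).union) (finProdFinEquiv.symm ⟨k, h⟩).1 n v
        (finProdFinEquiv.symm ⟨k, h⟩).2
    else 0
  | (.share, n, v), k =>
    if h : k < numEntities x * p.s then
      (sharePoly x ω n (unionEntity x (finProdFinEquiv.symm ⟨k, h⟩).1)
        (finProdFinEquiv.symm ⟨k, h⟩).2).eval (p.α v)
    else 0
  | (.query, n, v), k =>
    if h : k < numLocal x n * numEntities x then
      (queryPoly ω n (localEntity x n (finProdFinEquiv.symm ⟨k, h⟩).1)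
        (unionEntity x (finProdFinEquiv.symm ⟨k, h⟩).2)).eval (p.α v)
    else 0

/-- The answer of client `v` to the query of client `n` in a slot. -/
noncomputable def slotAnswer (v n : Fin p.N) (i : Fin (Fintype.card U)) (c : Fin p.s) : F :=
  (ansPoly x ω n (entityAt x n i) c).eval (p.α v)

/-- The answers in all slots, encrypted. -/
noncomputable def slotCipher (v n : Fin p.N) (i : Fin (Fintype.card U)) (c : Fin p.s) :
    S.phe.CT l :=
  S.phe.enc l (publicKey ω n) (slotAnswer x ω v n i c) ((ω.1 v).encCoin n i c)

lemma numLocal_le (n : Fin p.N) : numLocal x n ≤ Fintype.card U := Finset.card_le_univ _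

lemma serverView_eq : serverView x ω codeF =
    relayView S codeF (entityUnion x) (numLocal x) (numLocal_le x)
      (fun i => (sendPub ω i.1 i.2.1 i.2.2, recvPub ω i.1 i.2.1 i.2.2)) (publicKey ω)
      (fun i k => plainStream x ω i k + sendPad ω i.1 i.2.1 i.2.2 k) (slotCipher x ω) ω.2 := by
  have h1 : ∀ n v i, unionWire x ω n v i =
      plainStream x ω (.union, n, v) i + sendPad ω .union n v i := fun n v i => by
    simp [unionWire, padEnc, plainStream]
  have h2 : ∀ n v i, shareWire x ω n v i =
      plainStream x ω (.share, n, v) i + sendPad ω .share n v i := fun n v i => by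
    simp [shareWire, padEnc, plainStream]
  have h3 : ∀ n v i, queryWire x ω n v i =
      plainStream x ω (.query, n, v) i + sendPad ω .query n v i := fun n v i => by
    simp [queryWire, padEnc, plainStream]
  have h4 : ∀ v n j c, encAnswer x ω v n j c = slotCipher x ω v n (slot x n j) c :=
    fun v n j c => by
      unfold encAnswer slotCipher slotAnswer
      rw [answer_eq, entityAt_slot]
  simp only [serverView, relayView, h1, h2, h3, h4]
  rfl

/-- The secrets of the key exchanges, by pads. -/
def getSecrets (i : PadIndex p) : S.kex.Secret l × S.kex.Secret l :=
  ((ω.1 i.2.1).sendSecret i.1 i.2.2, (ω.1 i.2.2).recvSecret i.1 i.2.1)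

/-- The coins with all secrets of the key exchanges replaced. -/
def setSecrets (b : PadIndex p → S.kex.Secret l × S.kex.Secret l) (ω : Coins p S l) :
    Coins p S l :=
  (fun n => { ω.1 n with
    sendSecret := fun a v => (b (a, n, v)).1
    recvSecret := fun a v => (b (a, v, n)).2 }, ω.2)

/-- The numbering of the encrypted answers under one public key: by the answering client, the
slot, and the coordinate. -/
def cipherIndex (p : Params F) (U : Type) [Fintype U] :
    Fin p.N × Fin (Fintype.card U) × Fin p.s ≃ Fin (p.N * (Fintype.card U * p.s)) :=
  ((Equiv.refl _).prodCongr finProdFinEquiv).trans finProdFinEquiv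

/-- The coins for the keys and ciphertexts of the homomorphic encryption, by public keys. -/
def getCipherCoins (n : Fin p.N) :
    S.phe.KeyCoin l × (Fin (p.N * (Fintype.card U * p.s)) → S.phe.EncCoin l) :=
  ((ω.1 n).keyCoin, fun k => (ω.1 ((cipherIndex p U).symm k).1).encCoin n
    ((cipherIndex p U).symm k).2.1 ((cipherIndex p U).symm k).2.2)

/-- The coins with those for the keys and the encrypted answers replaced. -/
def setCipherCoins
    (b : Fin p.N → S.phe.KeyCoin l × (Fin (p.N * (Fintype.card U * p.s)) → S.phe.EncCoin l))
    (ω : Coins p S l) : Coins p S l :=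
  (fun v => { ω.1 v with
    keyCoin := (b v).1
    encCoin := fun n i c => (b n).2 (cipherIndex p U (v, i, c)) }, ω.2)

/-- A finite sequence, continued by zeros. -/
def extendZero {k : ℕ} (w : Fin k → F) (i : ℕ) : F := if h : i < k then w ⟨i, h⟩ else 0

/-- The server's view, computed from the key exchange messages and the seeds of the pads. -/
noncomputable def seedView (y : PadIndex p → S.kex.Pub l × S.kex.Pub l × S.prg.Seed l) :
    List Bool :=
  relayView S codeF (entityUnion x) (numLocal x) (numLocal_le x)
    (fun i => ((y i).1, (y i).2.1)) (publicKey ω)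
    (fun i k => plainStream x ω i k + S.prg.gen l (y i).2.2 k) (slotCipher x ω) ω.2

/-- The server's view, computed from the secrets of the key exchanges and the pads. -/
noncomputable def padView
    (r : Coins p S l × (PadIndex p → S.kex.Secret l × S.kex.Secret l))
    (w : PadIndex p → Fin (streamLen S l) → F) : List Bool :=
  relayView S codeF (entityUnion x) (numLocal x) (numLocal_le x)
    (fun i => (S.kex.pub l (r.2 i).1, S.kex.pub l (r.2 i).2)) (publicKey r.1)
    (fun i k => plainStream x r.1 i k + extendZero (w i) k) (slotCipher x r.1) r.1.2

variable (S l) in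
/-- The coins of the games in which the masked messages are uniform. -/
abbrev MaskedCoins : Type :=
  (Coins p S l × (PadIndex p → S.kex.Secret l × S.kex.Secret l)) ×
    (PadIndex p → Fin (streamLen S l) → F)

/-- The server's view with uniform masked messages, computed from the public keys and the
encrypted answers. It depends on the inputs only through `B` and `L`. -/
noncomputable def cipherView (B : Finset U) (L : Fin p.N → ℕ) (hL : ∀ n, L n ≤ Fintype.card U)
    (r : MaskedCoins S l)
    (y : Fin p.N → S.phe.PK l × (Fin (p.N * (Fintype.card U * p.s)) → S.phe.CT l)) :
    List Bool :=
  relayView S codeF B L hL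
    (fun i => (S.kex.pub l (r.1.2 i).1, S.kex.pub l (r.1.2 i).2)) (fun n => (y n).1)
    (fun i => extendZero (r.2 i)) (fun v n i c => (y n).2 (cipherIndex p U (v, i, c))) r.1.1.2

/-- A public key and ciphertexts of the messages `m`. -/
def cipherSample (m : Fin (p.N * (Fintype.card U * p.s)) → F)
    (a : S.phe.KeyCoin l × (Fin (p.N * (Fintype.card U * p.s)) → S.phe.EncCoin l)) :
    S.phe.PK l × (Fin (p.N * (Fintype.card U * p.s)) → S.phe.CT l) :=
  (S.phe.pk l a.1, fun k => S.phe.enc l (S.phe.pk l a.1) (m k) (a.2 k))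

variable (S) in
/-- The ideal view: uniform masked messages and encryptions of zero. -/
noncomputable def idealDist (B : Finset U) (L : Fin p.N → ℕ) (hL : ∀ n, L n ≤ Fintype.card U)
    (l : ℕ) : PMF (List Bool) :=
  (PMF.uniformOfFintype (MaskedCoins S l × (Fin p.N →
    S.phe.KeyCoin l × (Fin (p.N * (Fintype.card U * p.s)) → S.phe.EncCoin l)))).map fun ω =>
      cipherView codeF B L hL ω.1 fun n => cipherSample (fun _ => 0) (ω.2 n)

/-- By the security of the key exchange, the seeds of the pads may be replaced by uniform seeds. The
reduction has to compute the masked messages from the seed, which is where the generator has to be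
computable by small circuits. -/
lemma serverDist_indist_seedView (hkex : S.kex.IsSecure S.prg.seedCode)
    (hprg : S.prg.IsSecure codeF) :
    CompIndist (fun l => serverDist S l x codeF) (fun l =>
      (PMF.uniformOfFintype (Coins p S l ×
        (PadIndex p → (S.kex.Secret l × S.kex.Secret l) × S.prg.Seed l))).map fun ω =>
          seedView codeF x ω.1 fun i =>
            (S.kex.pub l (ω.2 i).1.1, S.kex.pub l (ω.2 i).1.2, (ω.2 i).2)) := by
  have h0 : (fun l => serverDist S l x codeF) = fun l =>
      (PMF.uniformOfFintype (Coins p S l ×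
        (PadIndex p → (S.kex.Secret l × S.kex.Secret l)))).map fun ω =>
          seedView codeF x ω.1 fun i => (S.kex.pub l (ω.2 i).1, S.kex.pub l (ω.2 i).2,
            S.kex.key l (ω.2 i).1 (S.kex.pub l (ω.2 i).2)) := by
    funext l
    unfold serverDist
    rw [map_uniform_resample getSecrets setSecrets (fun _ => rfl) (fun _ _ => rfl)
      (fun _ _ _ => rfl)]
    congr 1
    funext ω
    rw [serverView_eq]
    rfl
  rw [h0]
  obtain ⟨⟨q, hq, hgen⟩, -⟩ := hprg (streamLen S) (polyBounded_streamLen S)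
  obtain ⟨c, hc⟩ := exists_computes_map codeF
  refine compIndist_hybrid (I := PadIndex p) (R := fun l => Coins p S l)
    (A := fun l _ => S.kex.Secret l × S.kex.Secret l)
    (B := fun l _ => (S.kex.Secret l × S.kex.Secret l) × S.prg.Seed l)
    (Y := fun l _ => S.kex.Pub l × S.kex.Pub l × S.prg.Seed l)
    (fun l _ _ a => (S.kex.pub l a.1, S.kex.pub l a.2, S.kex.key l a.1 (S.kex.pub l a.2)))
    (fun l _ _ a => (S.kex.pub l a.1.1, S.kex.pub l a.1.2, a.2))
    (fun l _ y => (S.kex.pubCode l).code y.1 ++ (S.kex.pubCode l).code y.2.1 ++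
      (S.prg.seedCode l).code y.2.2)
    (fun l ω y => seedView codeF x ω y) (fun _ _ => hkex)
    (q := fun l => relayCost S l (codeF.len * q l + c))
    (polyBounded_relayCost (((PolyBounded.const _).mul hq).add (.const _))) ?_
  intro l ω i y
  refine computes_relayView codeF _ _ _ (fun j => ?_) (fun n => Computes.const _) (fun j k hk => ?_)
    (fun v n i c => Computes.const _)
  · rcases eq_or_ne j i with rfl | hj
    · simp only [Function.update_self]
      exact Computes.slice (a := fun _ => []) (m := 0)
        (n := (S.kex.pubCode l).len + (S.kex.pubCode l).len) (fun _ => rfl)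
        (fun t => by simp [BitCode.length_code]) fun t => rfl
    · simp only [Function.update_of_ne hj]
      exact Computes.const _
  · rcases eq_or_ne j i with rfl | hj
    · simp only [Function.update_self]
      have h1 : Computes (fun t : S.kex.Pub l × S.kex.Pub l × S.prg.Seed l =>
          (S.kex.pubCode l).code t.1 ++ (S.kex.pubCode l).code t.2.1 ++
            (S.prg.seedCode l).code t.2.2) (fun t => (S.prg.seedCode l).code t.2.2) 0 :=
        Computes.slice (c := fun _ => [])
          (a := fun t => (S.kex.pubCode l).code t.1 ++ (S.kex.pubCode l).code t.2.1)
          (m := (S.kex.pubCode l).len + (S.kex.pubCode l).len)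
          (fun t => by simp [BitCode.length_code]) (fun t => BitCode.length_code _ _)
          fun t => by simp
      have h2 : Computes (S.prg.seedCode l).code
          (fun s => codeF.code (S.prg.gen l s k)) (codeF.len * q l) := by
        refine Computes.of_bits (fun s => codeF.length_code _) fun b hb => ?_
        obtain ⟨C, hC, hCe⟩ := hgen l k hk b hb
        exact (Computes.ofCircuit C hCe).mono hC
      refine ((h1.comp (h2.comp_right fun t : S.kex.Pub l × S.kex.Pub l × S.prg.Seed l => t.2.2)).comp
        ((hc fun y => plainStream x ω j k + y).comp_right fun t : S.kex.Pub l × S.kex.Pub l × S.prg.Seed l =>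
          S.prg.gen l t.2.2 k)).mono (by omega)
    · simp only [Function.update_of_ne hj]
      exact (Computes.const _).mono (Nat.zero_le _)

/-- By the pseudorandomness of the generator, the pads may be replaced by uniform pads. -/
lemma seedView_indist_padView (hprg : S.prg.IsSecure codeF) :
    CompIndist (fun l =>
      (PMF.uniformOfFintype (Coins p S l ×
        (PadIndex p → (S.kex.Secret l × S.kex.Secret l) × S.prg.Seed l))).map fun ω =>
          seedView codeF x ω.1 fun i =>
            (S.kex.pub l (ω.2 i).1.1, S.kex.pub l (ω.2 i).1.2, (ω.2 i).2))
      (fun l => (PMF.uniformOfFintype (MaskedCoins S l)).map fun ω =>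
        padView codeF x ω.1 ω.2) := by
  have h0 : (fun l =>
      (PMF.uniformOfFintype (Coins p S l ×
        (PadIndex p → (S.kex.Secret l × S.kex.Secret l) × S.prg.Seed l))).map fun ω =>
          seedView codeF x ω.1 fun i =>
            (S.kex.pub l (ω.2 i).1.1, S.kex.pub l (ω.2 i).1.2, (ω.2 i).2)) = fun l =>
      (PMF.uniformOfFintype ((Coins p S l ×
        (PadIndex p → S.kex.Secret l × S.kex.Secret l)) × (PadIndex p → S.prg.Seed l))).map
          fun ω => padView codeF x ω.1 fun i k => S.prg.gen l (ω.2 i) k := by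
    funext l
    refine map_uniform_eq_of_bijective
      (((Equiv.refl _).prodCongr (Equiv.arrowProdEquivProdArrow _ _ _)).trans
        (Equiv.prodAssoc _ _ _).symm) (Equiv.bijective _) fun ω => ?_
    refine relayView_congr codeF _ _ _ _ _ _ fun i k hk => ?_
    simp [extendZero, hk, Equiv.arrowProdEquivProdArrow]
  rw [h0]
  obtain ⟨-, hgen⟩ := hprg (streamLen S) (polyBounded_streamLen S)
  obtain ⟨c, hc⟩ := exists_computes_map codeF
  refine compIndist_hybrid (I := PadIndex p)
    (R := fun l => Coins p S l × (PadIndex p → S.kex.Secret l × S.kex.Secret l))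
    (A := fun l _ => S.prg.Seed l) (B := fun l _ => Fin (streamLen S l) → F)
    (Y := fun l _ => Fin (streamLen S l) → F)
    (fun l _ _ s k => S.prg.gen l s k) (fun l _ _ w => w)
    (fun l _ w => concat fun k => codeF.code (w k))
    (fun l r w => padView codeF x r w) (fun _ _ => hgen)
    (q := fun l => relayCost S l c) (polyBounded_relayCost (.const _)) ?_
  intro l r i y
  refine computes_relayView codeF _ _ _ (fun j => Computes.const _) (fun n => Computes.const _)
    (fun j k hk => ?_) (fun v n i c => Computes.const _)
  rcases eq_or_ne j i with rfl | hj
  · simp only [Function.update_self, extendZero, hk, dite_true]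
    have h1 := Computes.block (f := fun (w : Fin (streamLen S l) → F) k => codeF.code (w k))
      (fun w k => codeF.length_code _) ⟨k, hk⟩
    exact (h1.comp ((hc fun y => plainStream x r.1 j k + y).comp_right
      fun w : Fin (streamLen S l) → F => w ⟨k, hk⟩)).mono (by omega)
  · simp only [Function.update_of_ne hj]
    exact (Computes.const _).mono (Nat.zero_le _)

/-- With uniform pads the masked messages are uniform, whatever the messages are. -/
lemma map_padView_eq (l : ℕ) :
    ((PMF.uniformOfFintype (MaskedCoins S l)).map fun ω => padView codeF x ω.1 ω.2) =
      (PMF.uniformOfFintype (MaskedCoins S l × (Fin p.N →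
        S.phe.KeyCoin l × (Fin (p.N * (Fintype.card U * p.s)) → S.phe.EncCoin l)))).map fun ω =>
          cipherView codeF (entityUnion x) (numLocal x) (numLocal_le x) ω.1 fun n =>
            cipherSample (fun k => slotAnswer x ω.1.1.1 ((cipherIndex p U).symm k).1 n
              ((cipherIndex p U).symm k).2.1 ((cipherIndex p U).symm k).2.2) (ω.2 n) := by
  let shift : MaskedCoins S l ≃ MaskedCoins S l :=
    Equiv.prodShear (Equiv.refl _) fun r => Equiv.addRight fun i k => plainStream x r.1 i k
  rw [map_uniform_eq_of_bijective (g := fun ω : MaskedCoins S l =>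
      relayView S codeF (entityUnion x) (numLocal x) (numLocal_le x)
        (fun i => (S.kex.pub l (ω.1.2 i).1, S.kex.pub l (ω.1.2 i).2)) (publicKey ω.1.1)
        (fun i => extendZero (ω.2 i)) (slotCipher x ω.1.1) ω.1.1.2) shift shift.bijective ?_,
    map_uniform_resample (fun ω : MaskedCoins S l => getCipherCoins ω.1.1)
      (fun b ω => ((setCipherCoins b ω.1.1, ω.1.2), ω.2))]
  · congr 1
    funext ω
    simp only [cipherView, cipherSample, Equiv.symm_apply_apply]
    rfl
  · intro ω
    simp [getCipherCoins, setCipherCoins]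
  · intro b ω
    funext n
    simp [getCipherCoins, setCipherCoins]
  · intro b b' ω
    rfl
  · intro ω
    refine relayView_congr codeF _ _ _ _ _ _ fun i k hk => ?_
    simp [shift, extendZero, hk, add_comm]

/-- By semantic security, the encrypted answers may be replaced by encryptions of zero. The coins on
which the answers depend are fixed separately for each security parameter, so the security for
sequences of messages is used. -/
lemma cipherView_indist_ideal (hphe : S.phe.IsSecure) :
    CompIndist (fun l => (PMF.uniformOfFintype (MaskedCoins S l)).map fun ω =>
        padView codeF x ω.1 ω.2)
      (idealDist S codeF (entityUnion x) (numLocal x) (numLocal_le x)) := by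
  simp only [map_padView_eq]
  refine compIndist_hybrid (I := Fin p.N) (R := fun l => MaskedCoins S l)
    (A := fun l _ => S.phe.KeyCoin l × (Fin (p.N * (Fintype.card U * p.s)) → S.phe.EncCoin l))
    (B := fun l _ => S.phe.KeyCoin l × (Fin (p.N * (Fintype.card U * p.s)) → S.phe.EncCoin l))
    (Y := fun l _ => S.phe.PK l × (Fin (p.N * (Fintype.card U * p.s)) → S.phe.CT l))
    (fun l r n => cipherSample fun k => slotAnswer x r.1.1 ((cipherIndex p U).symm k).1 n
      ((cipherIndex p U).symm k).2.1 ((cipherIndex p U).symm k).2.2)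
    (fun l _ _ => cipherSample fun _ => 0)
    (fun l _ y => (S.phe.pkCode l).code y.1 ++ concat fun k => (S.phe.ctCode l).code (y.2 k))
    (fun l r y => cipherView codeF _ _ (numLocal_le x) r y)
    (fun n r => hphe _ (fun l k => slotAnswer x (r l).1.1 ((cipherIndex p U).symm k).1 n
      ((cipherIndex p U).symm k).2.1 ((cipherIndex p U).symm k).2.2) fun _ _ => 0)
    (q := fun l => relayCost S l 0) (polyBounded_relayCost (.const _)) ?_
  intro l r n₀ y
  refine computes_relayView codeF _ _ _ (fun j => Computes.const _) (fun n => ?_)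
    (fun j k hk => Computes.const _) (fun v n i c => ?_)
  · rcases eq_or_ne n n₀ with rfl | hn
    · simp only [Function.update_self]
      exact Computes.slice (a := fun _ => []) (m := 0) (fun _ => rfl)
        (fun t => BitCode.length_code _ _) fun t => rfl
    · simp only [Function.update_of_ne hn]
      exact Computes.const _
  · rcases eq_or_ne n n₀ with rfl | hn
    · simp only [Function.update_self]
      have h1 : Computes
          (fun t : S.phe.PK l × (Fin (p.N * (Fintype.card U * p.s)) → S.phe.CT l) =>
            (S.phe.pkCode l).code t.1 ++ concat fun k => (S.phe.ctCode l).code (t.2 k))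
          (fun t => concat fun k => (S.phe.ctCode l).code (t.2 k)) 0 :=
        Computes.slice (a := fun t => (S.phe.pkCode l).code t.1) (c := fun _ => []) (n := (p.N * (Fintype.card U * p.s)) *
          (S.phe.ctCode l).len) (fun t => BitCode.length_code _ _)
          (fun t => by simp [concat, List.length_flatten, BitCode.length_code,
            Function.comp_def]) fun t => by simp
      exact h1.comp (Computes.block
        (f := fun (t : S.phe.PK l × (Fin (p.N * (Fintype.card U * p.s)) → S.phe.CT l)) k =>
          (S.phe.ctCode l).code (t.2 k)) (fun t k => BitCode.length_code _ _) _)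
    · simp only [Function.update_of_ne hn]
      exact Computes.const _

lemma idealDist_congr {B B' : Finset U} {L L' : Fin p.N → ℕ} (hB : B = B') (hL : L = L')
    (h : ∀ n, L n ≤ Fintype.card U) (h' : ∀ n, L' n ≤ Fintype.card U) :
    idealDist S codeF B L h = idealDist S codeF B' L' h' := by
  subst hB
  subst hL
  rfl

/-- The view of the server is indistinguishable from the ideal view, which depends only on the
union of the entity sets and their cardinalities. -/
theorem privateAgainstServer (hkex : S.kex.IsSecure S.prg.seedCode)
    (hprg : S.prg.IsSecure codeF) (hphe : S.phe.IsSecure) : PrivateAgainstServer p S codeF := by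
  have key : ∀ x : Inputs U p, CompIndist (fun l => serverDist S l x codeF)
      (idealDist S codeF (entityUnion x) (numLocal x) (numLocal_le x)) := fun x =>
    (serverDist_indist_seedView codeF x hkex hprg).trans
      ((seedView_indist_padView codeF x hprg).trans (cipherView_indist_ideal codeF x hphe))
  intro x x' h
  have h1 := key x
  rw [idealDist_congr codeF h.1 (funext h.2) _ (numLocal_le x')] at h1
  exact h1.trans (key x').symm

end Server

end SecEA

theorem theorem1 {F U : Type} [Field F] [Fintype F] [Fintype U] [LinearOrder U]
    (codeF : SecEA.BitCode F) (p : SecEA.Params F) (S : SecEA.Primitives F U p.N) :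
    SecEA.IsCorrect p S ∧
    SecEA.PerfectlyPrivateAfterUnion p S ∧
    (S.psu.IsPrivate p.T → SecEA.PrivateAgainstCoalitions p S) ∧
    (S.kex.IsSecure S.prg.seedCode → S.prg.IsSecure codeF → S.phe.IsSecure →
      SecEA.PrivateAgainstServer p S codeF) := by
  exact ⟨SecEA.isCorrect p S, SecEA.perfectlyPrivateAfterUnion p S,
    SecEA.privateAgainstCoalitions p S, SecEA.privateAgainstServer codeF⟩
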